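/- Consider a dual-branch ($L=2$) $L_p$-norm diversity receiver with output SNR $\gamma_{\rm end}=\mathrm K\frac{E_s}{N_0}(\mathcal R_1^p+\mathcal R_2^p)^q$, where $p\neq 0$ is real, $q\ge 1$ is an integer and $\mathrm K,E_s,N_0>0$. The fading envelopes $\mathcal R_1,\mathcal R_2$ are independent, and $\mathcal R_\ell$ has the Gamma-shadowed generalized Nakagami-$m$ (GSNM) distribution with parameters $m_\ell\ge\frac12$, $\beta_\ell>0$, $m_{s\ell}\ge\frac12$, $\Omega_{s\ell}>0$: conditionally on $W=w$ it has the density $\frac{\beta_\ell}{\Gamma(m_\ell)}(b_\ell/w)^{\beta_\ell m_\ell/2}r^{\beta_\ell m_\ell-1}\exp[-(b_\ell/w)^{\beta_\ell/2}r^{\beta_\ell}]$, $r>0$, with $b_\ell=\Gamma(m_\ell+2/\beta_\ell)/\Gamma(m_\ell)$, and $W$ is Gamma distributed with shape $m_{s\ell}$ and mean $\Omega_{s\ell}$. Let $\theta,T,B>0$ and $A=\theta TB/\ln 2$. For real triples and pairs of parameters, the bivariate Fox H-function $H^{0,n_1:m_2,n_2:m_3,n_3}_{p_1,q_1:p_2,q_2:p_3,q_3}$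 at $(x_1,x_2)$, with joint parameters $(a_j;\alpha_j,A_j)_{j\le p_1}$, $(b_j;\beta_j,B_j)_{j\le q_1}$, parameters $(c_j,\gamma_j)_{j\le p_2}$, $(d_j,\delta_j)_{j\le q_2}$ for the first variable and $(e_j,\epsilon_j)_{j\le p_3}$, $(f_j,\phi_j)_{j\le q_3}$ for the second, is $$\frac{1}{(2\pi\imath)^2}\int_{\mathcal C_1}\int_{\mathcal C_2}\phi(t_1,t_2)\,\phi_1(t_1)\,\phi_2(t_2)\,x_1^{t_1}x_2^{t_2}\,\mathrm dt_2\,\mathrm dt_1,$$ $$\phi(t_1,t_2)=\frac{\prod_{j\le n_1}\Gamma(1-a_j+\alpha_jt_1+A_jt_2)}{\prod_{j>n_1}\Gamma(a_j-\alpha_jt_1-A_jt_2)\prod_{j}\Gamma(1-b_j+\beta_jt_1+B_jt_2)},\qquad \phi_1(t)=\frac{\prod_{j\le m_2}\Gamma(d_j-\delta_jt)\prod_{j\le n_2}\Gamma(1-c_j+\gamma_jt)}{\prod_{j>m_2}\Gamma(1-d_j+\delta_jt)\prod_{j>n_2}\Gamma(c_j-\gamma_jt)},$$ $\phi_2$ being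 formed likewise from $m_3,n_3,(e_j,\epsilon_j),(f_j,\phi_j)$, where $\mathcal C_1,\mathcal C_2$ are vertical lines on which all Gamma functions in the numerators have arguments with positive real part. Then the effective capacity under optimal rate adaptation, $R^{\rm ORA}(\theta)=-\frac{1}{\theta TB}\ln\mathbb E\langle(1+\gamma_{\rm end})^{-A}\rangle$, is $$R^{\rm ORA}(\theta)=-\frac{1}{\theta TB}\ln\left\{\frac{(2\pi)^{q/2-1/2}}{\sqrt q\,\Gamma(m_{s1})\Gamma(m_{s2})\Gamma(m_1)\Gamma(m_2)\Gamma(A)\,\pi}\,\mathcal H\right\},$$ where $\mathcal H$ is the value of $H^{0,1:2,2:2,2}_{q,0:2,2:2,2}$ at $$x_\ell=\left(\frac{\Omega_{s\ell}}{b_\ell m_{s\ell}}\right)^p\left(\mathrm K\frac{E_s}{N_0}\right)^{2/q}\frac{q^2}{4},\qquad \ell=1,2,$$ with joint parameters $(1-A;\frac2q,\frac2q),(\frac1q;\frac2q,\frac2q),\ldots,(\frac{q-1}q;\frac2q,\frac2q)$ and, for the $\ell$-th variable, upper parameters $(1-m_{s\ell},p),(1-m_\ell,\frac{2p}{\beta_\ell})$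 and lower parameters $(\frac12,1),(0,1)$. Here such lines exist, the double integral converges absolutely on all of them, its value $\mathcal H$ does not depend on their choice, and $\mathcal H$ is a positive real number. Moreover, if the channel realizations in successive blocks are independent copies of $(\mathcal R_1,\mathcal R_2)$ and $S[n]=BT\log_2(1+\gamma_{\rm end}[n])$ is the service in block $n$, then the limit $-\lim_{N\to\infty}\frac1{N\theta TB}\ln\mathbb E\langle\exp(-\theta\sum_{n=1}^NS[n])\rangle$ exists and has the same value. -/

import Mathlib

open MeasureTheory ProbabilityTheory Filter Topology

noncomputable section

/-! ## The bivariate Fox H-function -/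

/-- Orders and parameters of a bivariate Fox H-function
`H^{0,n₁ : m₂,n₂ : m₃,n₃}_{p₁,q₁ : p₂,q₂ : p₃,q₃}`.
`a` (length `p₁`) and `b` (length `q₁`) are the triples `(a_j; α_j, A_j)`, `(b_j; β_j, B_j)` of the
joint kernel, `c`, `d` the pairs `(c_j, γ_j)`, `(d_j, δ_j)` of the kernel in the first variable and
`e`, `f` the pairs of the kernel in the second variable. -/
structure FoxHData where
  n₁ : ℕ
  m₂ : ℕ
  n₂ : ℕ
  m₃ : ℕ
  n₃ : ℕ
  a : List (ℝ × ℝ × ℝ)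
  b : List (ℝ × ℝ × ℝ)
  c : List (ℝ × ℝ)
  d : List (ℝ × ℝ)
  e : List (ℝ × ℝ)
  f : List (ℝ × ℝ)

/-- The one-variable Mellin–Barnes kernel
`∏_{j ≤ m} Γ(d_j - δ_j s) ∏_{j ≤ n} Γ(1 - c_j + γ_j s)
  / (∏_{j > m} Γ(1 - d_j + δ_j s) ∏_{j > n} Γ(c_j - γ_j s))`. -/
def foxHKernel₁ (m n : ℕ) (c d : List (ℝ × ℝ)) (s : ℂ) : ℂ :=
  (((d.take m).map fun v => Complex.Gamma (v.1 - v.2 * s)).prod *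
      ((c.take n).map fun v => Complex.Gamma (1 - v.1 + v.2 * s)).prod) /
    (((d.drop m).map fun v => Complex.Gamma (1 - v.1 + v.2 * s)).prod *
      ((c.drop n).map fun v => Complex.Gamma (v.1 - v.2 * s)).prod)

/-- The joint Mellin–Barnes kernel
`∏_{j ≤ n} Γ(1 - a_j + α_j s + A_j t)
  / (∏_{j > n} Γ(a_j - α_j s - A_j t) ∏_j Γ(1 - b_j + β_j s + B_j t))`. -/
def foxHKernel₂ (n : ℕ) (a b : List (ℝ × ℝ × ℝ)) (s t : ℂ) : ℂ :=
  ((a.take n).map fun v => Complex.Gamma (1 - v.1 + v.2.1 * s + v.2.2 * t)).prod /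
    (((a.drop n).map fun v => Complex.Gamma (v.1 - v.2.1 * s - v.2.2 * t)).prod *
      (b.map fun v => Complex.Gamma (1 - v.1 + v.2.1 * s + v.2.2 * t)).prod)

namespace FoxHData

/-- The integrand `φ(s, t) φ₁(s) φ₂(t) x^s y^t`. -/
def integrand (G : FoxHData) (x y : ℝ) (s t : ℂ) : ℂ :=
  foxHKernel₂ G.n₁ G.a G.b s t * foxHKernel₁ G.m₂ G.n₂ G.c G.d s *
    foxHKernel₁ G.m₃ G.n₃ G.e G.f t * (x : ℂ) ^ s * (y : ℂ) ^ t

/-- The lines `Re s = κ.1`, `Re t = κ.2` are admissible contours: all Gamma functions in the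
numerator of the integrand have arguments with positive real part there. For positive coefficients
this says that the lines separate the poles of the `Γ(d_j - δ_j s)` and `Γ(f_j - φ_j t)` (on the
right) from those of the `Γ(1 - c_j + γ_j s)`, `Γ(1 - e_j + ε_j t)` and
`Γ(1 - a_j + α_j s + A_j t)` (on the left). -/
def Admissible (G : FoxHData) (κ : ℝ × ℝ) : Prop :=
  (∀ v ∈ G.a.take G.n₁, 0 < 1 - v.1 + v.2.1 * κ.1 + v.2.2 * κ.2) ∧
  (∀ v ∈ G.c.take G.n₂, 0 < 1 - v.1 + v.2 * κ.1) ∧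
  (∀ v ∈ G.d.take G.m₂, 0 < v.1 - v.2 * κ.1) ∧
  (∀ v ∈ G.e.take G.n₃, 0 < 1 - v.1 + v.2 * κ.2) ∧
  (∀ v ∈ G.f.take G.m₃, 0 < v.1 - v.2 * κ.2)

/-- The integrand on the two vertical lines, parametrised by the imaginary parts. -/
def lineIntegrand (G : FoxHData) (x y : ℝ) (κ : ℝ × ℝ) (τ : ℝ × ℝ) : ℂ :=
  G.integrand x y (κ.1 + τ.1 * Complex.I) (κ.2 + τ.2 * Complex.I)

/-- The double Mellin–Barnes integral
`(2πi)⁻² ∫_{Re s = κ.1} ∫_{Re t = κ.2} φ(s, t) φ₁(s) φ₂(t) x^s y^t dt ds`; here `ds dt = i² dτ`. -/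
def mellinBarnes (G : FoxHData) (x y : ℝ) (κ : ℝ × ℝ) : ℂ :=
  ((2 * Real.pi * Complex.I) ^ 2)⁻¹ * ∫ τ : ℝ × ℝ, G.lineIntegrand x y κ τ * Complex.I ^ 2

/-- The bivariate H-function is well defined at `(x, y)`: admissible contours exist, the
Mellin–Barnes integral converges absolutely on each of them, and its value does not depend on
the choice. -/
def WellDefined (G : FoxHData) (x y : ℝ) : Prop :=
  (∃ κ, G.Admissible κ) ∧
  (∀ κ, G.Admissible κ → Integrable (G.lineIntegrand x y κ)) ∧
  (∀ κ κ', G.Admissible κ → G.Admissible κ' → G.mellinBarnes x y κ = G.mellinBarnes x y κ')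

end FoxHData

open Classical in
/-- The value of the bivariate Fox H-function: the double Mellin–Barnes integral over admissible
contours (`0` if there are none). -/
def bivariateFoxH (G : FoxHData) (x y : ℝ) : ℂ :=
  if h : ∃ κ, G.Admissible κ then G.mellinBarnes x y h.choose else 0

/-! ## Gamma-shadowed generalized Nakagami-m fading -/

/-- `b = Γ(m + 2/β) / Γ(m)`. -/
def nakagamiB (m β : ℝ) : ℝ := Real.Gamma (m + 2 / β) / Real.Gamma m

/-- Density in `r` of the generalized Nakagami-`m` envelope with fading figure `m`, shaping factor
`β` and average power `w`. -/
def genNakagamiPDFReal (m β w r : ℝ) : ℝ :=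
  if 0 < r then
    β / Real.Gamma m * (nakagamiB m β / w) ^ (β * m / 2) * r ^ (β * m - 1) *
      Real.exp (-((nakagamiB m β / w) ^ (β / 2) * r ^ β))
  else 0

/-- Density of the Gamma-shadowed generalized Nakagami-`m` (GSNM) envelope: the average power of a
generalized Nakagami-`m` envelope is itself Gamma distributed, with shape `ms` and mean `Ωs`. -/
def gsnmPDF (m β ms Ωs r : ℝ) : ENNReal :=
  ∫⁻ w in Set.Ioi (0 : ℝ),
    ENNReal.ofReal (genNakagamiPDFReal m β w r) * gammaPDF ms (ms / Ωs) w

/-- The GSNM distribution. -/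
def gsnmMeasure (m β ms Ωs : ℝ) : Measure ℝ := volume.withDensity (gsnmPDF m β ms Ωs)

/-! ## Receiver and effective capacity -/

/-- Instantaneous SNR `K (E_s/N₀) (∑ r_ℓ^p)^q` at the output of the `L_p`-norm receiver. -/
def lpNormSNR {L : ℕ} (K Es N₀ p q : ℝ) (r : Fin L → ℝ) : ℝ :=
  K * (Es / N₀) * (∑ l, r l ^ p) ^ q

/-- Normalized QoS exponent `A = θTB / ln 2`. -/
def qosExponent (θ T B : ℝ) : ℝ := θ * T * B / Real.log 2

/-- Service per block under optimal rate adaptation at SNR `γ`. -/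
def serviceORA (T B γ : ℝ) : ℝ := B * T * Real.logb 2 (1 + γ)

/-- `C` is the effective capacity `-lim_N (NθTB)⁻¹ ln E exp(-θ ∑_{n<N} S[n])` of the service
process `S`. -/
def IsEffectiveCapacity {Ω : Type*} [MeasurableSpace Ω] (P : Measure Ω) (θ T B : ℝ)
    (S : ℕ → Ω → ℝ) (C : ℝ) : Prop :=
  Tendsto (fun N : ℕ => -(1 / (N * θ * T * B) *
    Real.log (∫ ω, Real.exp (-θ * ∑ n ∈ Finset.range N, S n ω) ∂P))) atTop (𝓝 C)

/-- Effective capacity under optimal rate adaptation, `-(θTB)⁻¹ ln E[(1 + γ)^(-A)]`, for the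
output SNR `γ`. -/
def effectiveCapacityORA {Ω : Type*} [MeasurableSpace Ω] (P : Measure Ω) (θ T B : ℝ)
    (γ : Ω → ℝ) : ℝ :=
  -(1 / (θ * T * B)) * Real.log (∫ ω, (1 + γ ω) ^ (-qosExponent θ T B) ∂P)

/-! ## The ingredients of the closed form -/

/-- Data of `H^{0,1 : 2,2 : 2,2}_{q,0 : 2,2 : 2,2}` with joint parameters
`(1 - A; 2/q, 2/q), (1/q; 2/q, 2/q), …, ((q-1)/q; 2/q, 2/q)` and, for each branch, parameters
`(1 - ms, p), (1 - m, 2p/β)` and `(1/2, 1), (0, 1)`. -/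
def dualGSNMFoxHData (q : ℕ) (p A : ℝ) (m β ms : Fin 2 → ℝ) : FoxHData where
  n₁ := 1
  m₂ := 2
  n₂ := 2
  m₃ := 2
  n₃ := 2
  a := (1 - A, 2 / (q : ℝ), 2 / (q : ℝ)) ::
    (List.range (q - 1)).map fun j => (((j : ℝ) + 1) / (q : ℝ), 2 / (q : ℝ), 2 / (q : ℝ))
  b := []
  c := [(1 - ms 0, p), (1 - m 0, 2 * p / β 0)]
  d := [(1 / 2, 1), (0, 1)]
  e := [(1 - ms 1, p), (1 - m 1, 2 * p / β 1)]
  f := [(1 / 2, 1), (0, 1)]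

end

/-!
The expectation of `(1 + γ) ^ (-A)`, with `γ = c (X + Y) ^ q`, `X = R₁ ^ p`, `Y = R₂ ^ p`, is
evaluated by Parseval's identity for the two-dimensional Mellin transform, and the Mellin–Barnes
integrand of the H-function is recognised as the integrand of that identity. Everything is done in
the coordinates `log X`, `log Y`, where Mellin transforms become integrals over `ℝ`.

* Mellin transform of the weight. The map `(x₁, x₂) ↦ (x₂ - x₁, log (e ^ x₁ + e ^ x₂))` preserves
  Lebesgue measure (`measurePreserving_ratioSumMap`), so the double integral of
  `f (e ^ x₁ + e ^ x₂) e ^ (u x₁ + v x₂)` splits into a Beta integral and a Mellin transform of `f`.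
  For `f S = (1 + c S ^ q) ^ (-A)` this gives
  `q⁻¹ c ^ (-(u + v) / q) B(u, v) B((u + v) / q, A - (u + v) / q)`
  (`integral_snrWeight_exp_add_exp`); the Beta integral itself is the case `f S = e ^ (-S)`.
* Density of one branch. `log (R ^ p)` is a constant plus independent multiples of the logarithms of
  two Gamma variables (`gsnmMeasure_eq_map`). Its Laplace transform is a product of two Gamma
  functions, integrable on vertical lines, and Mellin inversion recovers the density
  (`logGSNMPDF_eq_integral`).
* Parseval. Inserting the inversion formula for both branches and exchanging integrals expresses
  the expectation as a double Mellin–Barnes integral (`integral_snrWeight_mul_density`). The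
  exchange is Fubini's theorem for a kernel whose modulus does not depend on the Mellin variables,
  so absolute convergence needs only the integrability of Gamma functions on vertical lines.
* Identification. Legendre's duplication formula merges `Γ(1/2 - s) Γ(-s)` into `Γ(-2 s)`, and
  Gauss's multiplication formula (`Complex.Gamma_multiplication`) merges the denominators of the
  joint kernel, so that the integrand is a constant times that of Parseval's identity
  (`lineIntegrand_dual`).

The argument applies on every pair of admissible lines. Hence it gives convergence, independence of
the lines, positivity and the closed form at once (`mellinBarnes_dual`). For independent blocks the
exponential moment of the accumulated service is the `N`-th power of the same expectation
(`isEffectiveCapacity_of_iid`).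
-/

/-! ### Gauss's multiplication formula -/

/-- The modulus of `∏ (1 - ζ ^ k) = q`, for a primitive `q`-th root of unity `ζ`. -/
theorem prod_sin_pi_mul_div {q : ℕ} (hq : 1 ≤ q) :
    ∏ k ∈ Finset.range (q - 1), Real.sin (Real.pi * ((k + 1 : ℝ) / q)) = q / 2 ^ (q - 1) := by
  obtain ⟨n, rfl⟩ : ∃ n, q = n + 1 := ⟨q - 1, by omega⟩
  have hn0 : (0 : ℝ) < ((n + 1 : ℕ) : ℝ) := by positivity
  have hζ := Complex.isPrimitiveRoot_exp (n + 1) n.succ_ne_zero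
  have h := congrArg norm hζ.prod_one_sub_pow_eq_order
  rw [norm_prod] at h
  have key : ∀ k ∈ Finset.range n,
      ‖1 - Complex.exp (2 * Real.pi * Complex.I / ((n + 1 : ℕ) : ℂ)) ^ (k + 1)‖ =
        2 * Real.sin (Real.pi * ((k + 1 : ℝ) / ((n + 1 : ℕ) : ℝ))) := by
    intro k hk
    have hk' : ((k : ℝ) + 1) ≤ ((n + 1 : ℕ) : ℝ) := by
      have := Finset.mem_range.mp hk
      exact_mod_cast (by omega : k + 1 ≤ n + 1)
    rw [← Complex.exp_nat_mul]
    have e : (((k + 1 : ℕ) : ℂ) * (2 * Real.pi * Complex.I / ((n + 1 : ℕ) : ℂ))) =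
        Complex.I * ((2 * (Real.pi * ((k + 1 : ℝ) / ((n + 1 : ℕ) : ℝ))) : ℝ) : ℂ) := by
      push_cast; ring
    rw [e, norm_sub_rev, Complex.norm_exp_I_mul_ofReal_sub_one, Real.norm_eq_abs,
      mul_div_cancel_left₀ _ two_ne_zero, abs_of_nonneg]
    refine mul_nonneg two_pos.le (Real.sin_nonneg_of_nonneg_of_le_pi (by positivity) ?_)
    have : ((k : ℝ) + 1) / ((n + 1 : ℕ) : ℝ) ≤ 1 := by rw [div_le_one hn0]; exact hk'
    nlinarith [Real.pi_pos]
  rw [Finset.prod_congr rfl key, Finset.prod_mul_distrib, Finset.prod_const, Finset.card_range] at h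
  have h2 : ‖((n : ℂ) + 1)‖ = ((n + 1 : ℕ) : ℝ) := by
    rw [show (n : ℂ) + 1 = ((n + 1 : ℕ) : ℂ) by push_cast; ring, Complex.norm_natCast]
  rw [h2] at h
  rw [add_tsub_cancel_right, eq_div_iff (by positivity), mul_comm]
  exact h

/-- The constant in the multiplication formula: pair each factor with its reflection. -/
theorem prod_Gamma_div {q : ℕ} (hq : 1 ≤ q) :
    ∏ k ∈ Finset.range (q - 1), Real.Gamma ((k + 1 : ℝ) / q) =
      (2 * Real.pi) ^ (((q : ℝ) - 1) / 2) / Real.sqrt q := by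
  have hq0 : (0 : ℝ) < q := by exact_mod_cast hq
  set G := ∏ k ∈ Finset.range (q - 1), Real.Gamma ((k + 1 : ℝ) / q) with hG
  have hGpos : 0 < G := Finset.prod_pos fun k _ => Real.Gamma_pos_of_pos (by positivity)
  have hrefl : G = ∏ k ∈ Finset.range (q - 1), Real.Gamma (1 - (k + 1 : ℝ) / q) := by
    rw [hG, ← Finset.prod_range_reflect]
    refine Finset.prod_congr rfl fun k hk => ?_
    have := Finset.mem_range.mp hk
    congr 1
    have e : ((q - 1 - 1 - k : ℕ) : ℝ) = q - 2 - k := by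
      rw [show q - 1 - 1 - k = q - (2 + k) by omega, Nat.cast_sub (by omega)]
      push_cast; ring
    rw [e]
    field_simp
    ring
  have hsq : G * G = (2 * Real.pi) ^ (q - 1) / q := by
    nth_rewrite 2 [hrefl]
    rw [hG, ← Finset.prod_mul_distrib]
    simp_rw [Real.Gamma_mul_Gamma_one_sub]
    rw [Finset.prod_div_distrib, prod_sin_pi_mul_div hq, Finset.prod_const, Finset.card_range,
      mul_pow]
    field_simp
  have hsq' : ((2 * Real.pi) ^ (((q : ℝ) - 1) / 2) / Real.sqrt q) *
      ((2 * Real.pi) ^ (((q : ℝ) - 1) / 2) / Real.sqrt q) = (2 * Real.pi) ^ (q - 1) / q := by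
    rw [div_mul_div_comm, Real.mul_self_sqrt hq0.le, ← Real.rpow_add (by positivity), add_halves,
      ← Real.rpow_natCast, Nat.cast_sub hq, Nat.cast_one]
  exact (mul_self_inj hGpos.le (by positivity)).mp (hsq.trans hsq'.symm)

/-- Gauss's multiplication formula for positive real arguments, up to its constant. As for the
duplication formula, `s ↦ q ^ s ∏ Γ((s + j) / q)` is log-convex and satisfies the functional
equation of `Γ`, so the Bohr–Mollerup theorem applies. -/
theorem rpow_mul_prod_Gamma_eq {q : ℕ} (hq : 1 ≤ q) {s : ℝ} (hs : 0 < s) :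
    (q : ℝ) ^ (s - 1) * ∏ j ∈ Finset.range q, Real.Gamma ((s + j) / q) =
      (∏ j ∈ Finset.range q, Real.Gamma ((1 + j : ℝ) / q)) * Real.Gamma s := by
  have hq0 : (0 : ℝ) < q := by exact_mod_cast hq
  set C := ∏ j ∈ Finset.range q, Real.Gamma ((1 + j : ℝ) / q) with hC
  have hCpos : 0 < C := Finset.prod_pos fun k _ => Real.Gamma_pos_of_pos (by positivity)
  set f : ℝ → ℝ := fun s => (q : ℝ) ^ (s - 1) *
    (∏ j ∈ Finset.range q, Real.Gamma ((s + j) / q)) / C with hf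
  have hGpos : ∀ {y : ℝ}, 0 < y → ∀ j ∈ Finset.range q, 0 < Real.Gamma ((y + j) / q) :=
    fun hy j _ => Real.Gamma_pos_of_pos (by positivity)
  have hpos : ∀ {y : ℝ}, 0 < y → 0 < f y := fun {y} hy => by
    have := Finset.prod_pos (hGpos hy)
    simp only [hf]; positivity
  have hfeq : ∀ {y : ℝ}, 0 < y → f (y + 1) = y * f y := by
    intro y hy
    have h1 : ∏ j ∈ Finset.range q, Real.Gamma ((y + 1 + j) / q) =
        (y / q) * ∏ j ∈ Finset.range q, Real.Gamma ((y + j) / q) := by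
      obtain ⟨n, rfl⟩ : ∃ n, q = n + 1 := ⟨q - 1, by omega⟩
      rw [Finset.prod_range_succ, Finset.prod_range_succ' (fun j : ℕ =>
        Real.Gamma ((y + j) / ((n + 1 : ℕ) : ℝ)))]
      have : (y + 1 + n) / ((n + 1 : ℕ) : ℝ) = (y + (0 : ℕ)) / ((n + 1 : ℕ) : ℝ) + 1 := by
        push_cast; field_simp; ring
      rw [this, Real.Gamma_add_one (by push_cast; positivity)]
      have : ∀ j : ℕ, y + 1 + (j : ℝ) = y + ((j + 1 : ℕ) : ℝ) := fun j => by push_cast; ring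
      simp_rw [this]
      simp only [Nat.cast_zero, add_zero]
      ring
    simp only [hf]
    rw [h1, show y + 1 - 1 = (y - 1) + 1 by ring, Real.rpow_add_one hq0.ne']
    field_simp
  have hone : f 1 = 1 := by
    simp only [hf, sub_self, Real.rpow_zero, one_mul]
    exact div_self hCpos.ne'
  have hconv : ConvexOn ℝ (Set.Ioi 0) (Real.log ∘ f) := by
    have h1 : ConvexOn ℝ (Set.Ioi (0 : ℝ)) fun s : ℝ =>
        ((s - 1) * Real.log q + ∑ j ∈ Finset.range q, Real.log (Real.Gamma ((s + j) / q)))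
          + -Real.log C := by
      refine ConvexOn.add_const (ConvexOn.add ?_ ?_) _
      · refine ⟨convex_Ioi 0, fun x _ y _ a b _ _ hab => le_of_eq ?_⟩
        simp only [smul_eq_mul]
        linear_combination (Real.log q) * hab
      · refine ⟨convex_Ioi 0, fun x hx y hy a b ha hb hab => ?_⟩
        rw [Finset.smul_sum, Finset.smul_sum, ← Finset.sum_add_distrib]
        refine Finset.sum_le_sum fun j _ => ?_
        have hx' : (0 : ℝ) < (x + j) / q := by have : 0 < x := hx; positivity
        have hy' : (0 : ℝ) < (y + j) / q := by have : 0 < y := hy; positivity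
        have := Real.convexOn_log_Gamma.2 hx' hy' ha hb hab
        refine le_trans (le_of_eq ?_) this
        simp only [Function.comp_apply, smul_eq_mul]
        congr 2
        rw [show a = 1 - b by linarith]
        field_simp
        ring
    refine h1.congr fun s hs => ?_
    have hs' : (0 : ℝ) < s := hs
    simp only [Function.comp_apply, hf]
    have hP := Finset.prod_pos (hGpos hs')
    rw [Real.log_div (by positivity) hCpos.ne', Real.log_mul (by positivity) hP.ne',
      Real.log_rpow hq0, Real.log_prod (fun j hj => (hGpos hs' j hj).ne'), ← sub_eq_add_neg]
  have := Real.eq_Gamma_of_log_convex hconv hfeq hpos hone hs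
  simp only [hf] at this
  rw [div_eq_iff hCpos.ne'] at this
  rw [this, mul_comm]

theorem Real.Gamma_multiplication_of_pos {q : ℕ} (hq : 1 ≤ q) {x : ℝ} (hx : 0 < x) :
    ∏ j ∈ Finset.range q, Real.Gamma (x + j / q) =
      (2 * Real.pi) ^ (((q : ℝ) - 1) / 2) * (q : ℝ) ^ (1 / 2 - q * x) * Real.Gamma (q * x) := by
  have hq0 : (0 : ℝ) < q := by exact_mod_cast hq
  have h := rpow_mul_prod_Gamma_eq hq (mul_pos hq0 hx)
  have h1 : ∀ j : ℕ, ((q : ℝ) * x + j) / q = x + j / q := fun j => by field_simp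
  have hC : ∏ j ∈ Finset.range q, Real.Gamma ((1 + j : ℝ) / q) =
      (2 * Real.pi) ^ (((q : ℝ) - 1) / 2) / Real.sqrt q := by
    rw [← prod_Gamma_div hq]
    obtain ⟨n, rfl⟩ : ∃ n, q = n + 1 := ⟨q - 1, by omega⟩
    rw [Finset.prod_range_succ, add_tsub_cancel_right]
    have : (1 + n : ℝ) / ((n + 1 : ℕ) : ℝ) = 1 := by
      push_cast; rw [add_comm]; exact div_self (by positivity)
    rw [this, Real.Gamma_one, mul_one]
    simp_rw [add_comm (1 : ℝ)]
  simp_rw [h1] at h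
  rw [hC] at h
  have h2 : (q : ℝ) ^ (q * x - 1) * ((q : ℝ) ^ (1 / 2 - q * x) * Real.sqrt q) = 1 := by
    rw [Real.sqrt_eq_rpow, ← Real.rpow_add hq0, ← Real.rpow_add hq0]
    ring_nf
    exact Real.rpow_zero _
  have h3 : (q : ℝ) ^ (q * x - 1) ≠ 0 := by positivity
  have h4 : Real.sqrt q ≠ 0 := by positivity
  apply mul_left_cancel₀ h3
  rw [h, div_mul_eq_mul_div, div_eq_iff h4]
  linear_combination (-(2 * Real.pi) ^ (((q : ℝ) - 1) / 2) * Real.Gamma (q * x)) * h2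

/-- Gauss's multiplication formula, by analytic continuation of the reciprocals, which are
entire. -/
theorem Complex.Gamma_multiplication {q : ℕ} (hq : 1 ≤ q) (z : ℂ) :
    ∏ j ∈ Finset.range q, Complex.Gamma (z + (j / q : ℝ)) =
      (((2 * Real.pi) ^ (((q : ℝ) - 1) / 2) : ℝ) : ℂ) * (q : ℂ) ^ (1 / 2 - q * z) *
        Complex.Gamma (q * z) := by
  have hq0 : (0 : ℝ) < q := by exact_mod_cast hq
  have hqc : (q : ℂ) ≠ 0 := by exact_mod_cast hq0.ne'
  set C : ℂ := (((2 * Real.pi) ^ (((q : ℝ) - 1) / 2) : ℝ) : ℂ) with hC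
  suffices (fun z : ℂ => ∏ j ∈ Finset.range q, (Complex.Gamma (z + (j / q : ℝ)))⁻¹) =
      fun z : ℂ => C⁻¹ * (q : ℂ) ^ (q * z - 1 / 2) * (Complex.Gamma (q * z))⁻¹ by
    have h := congrArg Inv.inv (congrFun this z)
    simp only [Finset.prod_inv_distrib, inv_inv, mul_inv, ← Complex.cpow_neg, neg_sub] at h
    exact h
  have h1 : AnalyticOnNhd ℂ
      (fun z : ℂ => ∏ j ∈ Finset.range q, (Complex.Gamma (z + (j / q : ℝ)))⁻¹) Set.univ := by
    refine DifferentiableOn.analyticOnNhd ?_ isOpen_univ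
    refine (Differentiable.fun_finsetProd fun j _ => ?_).differentiableOn
    exact Complex.differentiable_one_div_Gamma.comp (differentiable_id.add (differentiable_const _))
  have h2 : AnalyticOnNhd ℂ
      (fun z : ℂ => C⁻¹ * (q : ℂ) ^ (q * z - 1 / 2) * (Complex.Gamma (q * z))⁻¹) Set.univ := by
    refine DifferentiableOn.analyticOnNhd ?_ isOpen_univ
    refine (Differentiable.mul (Differentiable.mul (differentiable_const _) ?_) ?_).differentiableOn
    · refine fun t => DifferentiableAt.const_cpow ?_ (Or.inl hqc)
      fun_prop
    · exact Complex.differentiable_one_div_Gamma.comp (differentiable_id.const_mul _)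
  have h3 : Tendsto ((↑) : ℝ → ℂ) (𝓝[≠] 1) (𝓝[≠] 1) := by
    rw [tendsto_nhdsWithin_iff]; constructor
    · exact tendsto_nhdsWithin_of_tendsto_nhds Complex.continuous_ofReal.continuousAt
    · exact eventually_nhdsWithin_iff.mpr
        (Eventually.of_forall fun t ht => Complex.ofReal_ne_one.mpr ht)
  refine AnalyticOnNhd.eq_of_frequently_eq h1 h2 (h3.frequently ?_)
  refine ((Eventually.filter_mono nhdsWithin_le_nhds) ?_).frequently
  refine (eventually_gt_nhds zero_lt_one).mp (Eventually.of_forall fun t ht => ?_)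
  rw [Finset.prod_inv_distrib]
  have h4 := congrArg (fun r : ℝ => (r : ℂ)) (Real.Gamma_multiplication_of_pos hq ht)
  simp only [Complex.ofReal_prod, Complex.ofReal_mul, ← Complex.Gamma_ofReal,
    Complex.ofReal_add, Complex.ofReal_cpow hq0.le, Complex.ofReal_natCast] at h4
  rw [h4, mul_inv, mul_inv, ← Complex.cpow_neg]
  congr 3
  push_cast
  ring

/-! ### Gamma and Beta integrals in logarithmic coordinates -/

theorem image_exp_univ : Real.exp '' Set.univ = Set.Ioi 0 := by
  rw [Set.image_univ, Real.range_exp]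

theorem abs_exp_smul_Gamma_integrand (s : ℂ) (x : ℝ) :
    |Real.exp x| • (((Real.exp (-Real.exp x) : ℝ) : ℂ) * ((Real.exp x : ℝ) : ℂ) ^ (s - 1)) =
      Complex.exp (s * x - Real.exp x) := by
  have h1 : ((Real.exp x : ℝ) : ℂ) ≠ 0 := by exact_mod_cast (Real.exp_pos x).ne'
  rw [abs_of_pos (Real.exp_pos x), Complex.real_smul, Complex.cpow_def_of_ne_zero h1,
    ← Complex.ofReal_log (Real.exp_pos x).le, Real.log_exp, Complex.ofReal_exp (-_),
    Complex.ofReal_exp x, ← Complex.exp_add, ← Complex.exp_add]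
  congr 1
  push_cast
  ring

theorem integrable_cexp_sub_exp {s : ℂ} (hs : 0 < s.re) :
    Integrable fun x : ℝ => Complex.exp (s * x - Real.exp x) := by
  have h := Complex.GammaIntegral_convergent hs
  rw [← image_exp_univ, integrableOn_image_iff_integrableOn_abs_deriv_smul MeasurableSet.univ
    (fun x _ => (Real.hasDerivAt_exp x).hasDerivWithinAt) Real.exp_injective.injOn,
    integrableOn_univ] at h
  simpa only [abs_exp_smul_Gamma_integrand] using h

theorem integral_cexp_sub_exp {s : ℂ} (hs : 0 < s.re) :
    ∫ x : ℝ, Complex.exp (s * x - Real.exp x) = Complex.Gamma s := by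
  rw [Complex.Gamma_eq_integral hs, Complex.GammaIntegral, ← image_exp_univ,
    integral_image_eq_integral_abs_deriv_smul MeasurableSet.univ
    (fun x _ => (Real.hasDerivAt_exp x).hasDerivWithinAt) Real.exp_injective.injOn,
    setIntegral_univ]
  simp only [abs_exp_smul_Gamma_integrand]

/-- The map `(x₁, x₂) ↦ (x₂ - x₁, log (e ^ x₁ + e ^ x₂))`: in logarithmic coordinates it sends a
pair of positive reals to their ratio and their sum. -/
noncomputable def ratioSumMap (x : ℝ × ℝ) : ℝ × ℝ :=
  (-x.1 + x.2, Real.log (1 + Real.exp (-x.1 + x.2)) + x.1)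

/-- A composition of two shears and a swap. -/
theorem measurePreserving_ratioSumMap : MeasurePreserving ratioSumMap := by
  have h1 : MeasurePreserving (fun x : ℝ × ℝ => (x.1, -x.1 + x.2)) :=
    measurePreserving_prod_neg_add volume volume
  have h2 : MeasurePreserving (Prod.swap : ℝ × ℝ → ℝ × ℝ) := Measure.measurePreserving_swap
  have h3 : MeasurePreserving
      (fun p : ℝ × ℝ => (id p.1, (fun z x => Real.log (1 + Real.exp z) + x) p.1 p.2)) := by
    refine (MeasurePreserving.id volume).skew_product
      (g := fun z x => Real.log (1 + Real.exp z) + x) (by unfold Function.uncurry; fun_prop) ?_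
    exact Filter.Eventually.of_forall fun z => map_add_left_eq_self _ _
  exact h3.comp (h2.comp h1)

theorem exp_ratioSumMap_snd (x : ℝ × ℝ) :
    Real.exp (ratioSumMap x).2 = Real.exp x.1 + Real.exp x.2 := by
  rw [ratioSumMap, Real.exp_add, Real.exp_log (by positivity), add_mul, one_mul, ← Real.exp_add]
  congr 2
  ring

/-- The factorised form, in the coordinates of `ratioSumMap`, of
`f (e ^ x₁ + e ^ x₂) e ^ (u x₁ + v x₂)`. -/
theorem comp_ratioSumMap (f : ℝ → ℂ) (u v : ℂ) :
    (fun z : ℝ × ℝ => Complex.exp (v * z.1 - (u + v) * Real.log (1 + Real.exp z.1)) *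
      (f (Real.exp z.2) * Complex.exp ((u + v) * z.2))) ∘ ratioSumMap =
    fun x : ℝ × ℝ => f (Real.exp x.1 + Real.exp x.2) * Complex.exp (u * x.1 + v * x.2) := by
  funext x
  simp only [Function.comp_apply, exp_ratioSumMap_snd]
  rw [mul_left_comm, ← Complex.exp_add]
  congr 2
  simp only [ratioSumMap]
  push_cast
  ring

theorem aestronglyMeasurable_ratioSum {f : ℝ → ℂ} (hf : Measurable f) (u v : ℂ) :
    AEStronglyMeasurable (fun z : ℝ × ℝ =>
      Complex.exp (v * z.1 - (u + v) * Real.log (1 + Real.exp z.1)) *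
        (f (Real.exp z.2) * Complex.exp ((u + v) * z.2))) := by
  refine Measurable.aestronglyMeasurable ?_
  fun_prop

theorem integral_comp_exp_add_exp {f : ℝ → ℂ} (hf : Measurable f) (u v : ℂ) :
    ∫ x : ℝ × ℝ, f (Real.exp x.1 + Real.exp x.2) * Complex.exp (u * x.1 + v * x.2) =
      (∫ z : ℝ, Complex.exp (v * z - (u + v) * Real.log (1 + Real.exp z))) *
        ∫ y : ℝ, f (Real.exp y) * Complex.exp ((u + v) * y) := by
  have hm := aestronglyMeasurable_ratioSum hf u v
  rw [← integral_prod_mul, ← Measure.volume_eq_prod, ← comp_ratioSumMap f u v]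
  conv_rhs => rw [← measurePreserving_ratioSumMap.map_eq]
  rw [integral_map measurePreserving_ratioSumMap.aemeasurable
    (by rwa [measurePreserving_ratioSumMap.map_eq])]
  rfl

theorem integrable_exp_mul_exp {u v : ℂ} (hu : 0 < u.re) (hv : 0 < v.re) :
    Integrable fun x : ℝ × ℝ => Complex.exp (-(Real.exp x.1 + Real.exp x.2 : ℝ)) *
      Complex.exp (u * x.1 + v * x.2) := by
  refine ((integrable_cexp_sub_exp hu).mul_prod (integrable_cexp_sub_exp hv)).congr
    (Eventually.of_forall fun x => ?_)
  simp only
  rw [← Complex.exp_add, ← Complex.exp_add]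
  congr 1
  push_cast
  ring

/-- Integrability is inherited from the product of two Gamma integrands, which factors through
`ratioSumMap`. -/
theorem integrable_beta_log {u v : ℂ} (hu : 0 < u.re) (hv : 0 < v.re) :
    Integrable fun z : ℝ => Complex.exp (v * z - (u + v) * Real.log (1 + Real.exp z)) := by
  have h := integrable_exp_mul_exp hu hv
  have hm : Measurable fun S : ℝ => Complex.exp (-(S : ℂ)) := by fun_prop
  rw [← comp_ratioSumMap (fun S : ℝ => Complex.exp (-(S : ℂ))) u v,
    measurePreserving_ratioSumMap.integrable_comp (aestronglyMeasurable_ratioSum hm u v),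
    Measure.volume_eq_prod] at h
  obtain ⟨y, hy⟩ := h.prod_left_ae.exists
  have hne : Complex.exp (-((Real.exp y : ℝ) : ℂ)) * Complex.exp ((u + v) * y) ≠ 0 :=
    mul_ne_zero (Complex.exp_ne_zero _) (Complex.exp_ne_zero _)
  simp only at hy
  exact (integrable_mul_const_iff (IsUnit.mk0 _ hne) _).mp hy

/-- Euler's Beta integral, in logarithmic coordinates. -/
theorem integral_beta_log {u v : ℂ} (hu : 0 < u.re) (hv : 0 < v.re) :
    ∫ z : ℝ, Complex.exp (v * z - (u + v) * Real.log (1 + Real.exp z)) =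
      Complex.Gamma u * Complex.Gamma v / Complex.Gamma (u + v) := by
  have huv : 0 < (u + v).re := by rw [Complex.add_re]; positivity
  have hm : Measurable fun S : ℝ => Complex.exp (-(S : ℂ)) := by fun_prop
  have h := integral_comp_exp_add_exp hm u v
  have h1 : ∫ y : ℝ, Complex.exp (-((Real.exp y : ℝ) : ℂ)) * Complex.exp ((u + v) * y) =
      Complex.Gamma (u + v) := by
    rw [← integral_cexp_sub_exp huv]
    congr 1
    funext y
    rw [← Complex.exp_add]
    congr 1
    ring
  have h2 : ∫ x : ℝ × ℝ, Complex.exp (-((Real.exp x.1 + Real.exp x.2 : ℝ) : ℂ)) *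
      Complex.exp (u * x.1 + v * x.2) = Complex.Gamma u * Complex.Gamma v := by
    rw [← integral_cexp_sub_exp hu, ← integral_cexp_sub_exp hv, ← integral_prod_mul,
      ← Measure.volume_eq_prod]
    congr 1
    funext x
    rw [← Complex.exp_add, ← Complex.exp_add]
    congr 1
    push_cast
    ring
  rw [h1, h2] at h
  rw [eq_div_iff (Complex.Gamma_ne_zero_of_re_pos huv), h]

/-! ### The Mellin transform of the SNR functional -/

/-- The function `(1 + c S ^ q) ^ (-A)` of `S = ∑ r_ℓ ^ p`, whose expectation enters the effective
capacity. The exponent `q` is real here. -/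
noncomputable def snrWeight (A c q S : ℝ) : ℝ := (1 + c * S ^ q) ^ (-A)

theorem measurable_snrWeight (A c q : ℝ) : Measurable (snrWeight A c q) := by
  unfold snrWeight
  fun_prop

theorem snrWeight_pos {A c q S : ℝ} (hc : 0 < c) (hS : 0 ≤ S) : 0 < snrWeight A c q S := by
  unfold snrWeight
  positivity

theorem snrWeight_le_one {A c q S : ℝ} (hA : 0 < A) (hc : 0 < c) (hS : 0 ≤ S) :
    snrWeight A c q S ≤ 1 := by
  refine Real.rpow_le_one_of_one_le_of_nonpos ?_ (by linarith)
  have : 0 ≤ c * S ^ q := by positivity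
  linarith

theorem snrWeight_exp_mul_cexp {A c q : ℝ} (hc : 0 < c) (hq : 0 < q) (σ : ℂ) (y : ℝ) :
    (snrWeight A c q (Real.exp y) : ℂ) * Complex.exp (σ * y) =
      Complex.exp (-(σ / q) * Real.log c) *
        Complex.exp ((σ / q) * ((q * y + Real.log c : ℝ) : ℂ) -
          ((A - σ / q) + σ / q) * Real.log (1 + Real.exp (q * y + Real.log c))) := by
  have hqc : (q : ℂ) ≠ 0 := by exact_mod_cast hq.ne'
  have h1 : snrWeight A c q (Real.exp y) =
      Real.exp (-A * Real.log (1 + Real.exp (q * y + Real.log c))) := by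
    rw [snrWeight, Real.rpow_def_of_pos (by positivity), ← Real.exp_mul, Real.exp_add,
      Real.exp_log hc]
    congr 1
    rw [mul_comm y q, mul_comm c]
    ring
  rw [h1, Complex.ofReal_exp, ← Complex.exp_add, ← Complex.exp_add]
  congr 1
  push_cast
  field_simp
  ring

theorem integrable_snrWeight_exp {A c q : ℝ} (hc : 0 < c) (hq : 0 < q) {σ : ℂ} (hσ : 0 < σ.re)
    (hσA : σ.re / q < A) :
    Integrable fun y : ℝ => (snrWeight A c q (Real.exp y) : ℂ) * Complex.exp (σ * y) := by
  simp_rw [snrWeight_exp_mul_cexp hc hq σ]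
  have h1 : 0 < (σ / q).re := by rw [Complex.div_ofReal_re]; positivity
  have h2 : 0 < ((A : ℂ) - σ / q).re := by
    rw [Complex.sub_re, Complex.ofReal_re, Complex.div_ofReal_re]; linarith
  have h := ((integrable_beta_log h2 h1).comp_add_right (Real.log c)).comp_mul_left' hq.ne'
  exact h.const_mul _

theorem integral_snrWeight_exp {A c q : ℝ} (hc : 0 < c) (hq : 0 < q) {σ : ℂ} (hσ : 0 < σ.re)
    (hσA : σ.re / q < A) :
    ∫ y : ℝ, (snrWeight A c q (Real.exp y) : ℂ) * Complex.exp (σ * y) =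
      Complex.exp (-(σ / q) * Real.log c) *
        (1 / q * (Complex.Gamma (A - σ / q) * Complex.Gamma (σ / q) / Complex.Gamma A)) := by
  simp_rw [snrWeight_exp_mul_cexp hc hq σ]
  have h1 : 0 < (σ / q).re := by rw [Complex.div_ofReal_re]; positivity
  have h2 : 0 < ((A : ℂ) - σ / q).re := by
    rw [Complex.sub_re, Complex.ofReal_re, Complex.div_ofReal_re]; linarith
  have h := integral_beta_log h2 h1
  rw [sub_add_cancel] at h
  rw [integral_const_mul, ← h]
  congr 1
  simp_rw [sub_add_cancel]
  set g : ℝ → ℂ := fun z => Complex.exp (σ / q * z - A * Real.log (1 + Real.exp z)) with hg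
  have h3 := Measure.integral_comp_mul_left (fun w => g (w + Real.log c)) q
  rw [integral_add_right_eq_self g] at h3
  rw [abs_of_pos (inv_pos.mpr hq), Complex.real_smul] at h3
  rw [one_div, ← Complex.ofReal_inv, ← h3]

/-- The joint kernel of the closed form is the two-dimensional Mellin transform of
`(1 + c (X + Y) ^ q) ^ (-A)`. -/
theorem integral_snrWeight_exp_add_exp {A c q : ℝ} (hc : 0 < c) (hq : 0 < q) {u v : ℂ}
    (hu : 0 < u.re) (hv : 0 < v.re) (huv : (u + v).re / q < A) :
    ∫ x : ℝ × ℝ, (snrWeight A c q (Real.exp x.1 + Real.exp x.2) : ℂ) *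
        Complex.exp (u * x.1 + v * x.2) =
      Complex.Gamma u * Complex.Gamma v / Complex.Gamma (u + v) *
        (Complex.exp (-((u + v) / q) * Real.log c) * (1 / q * (Complex.Gamma (A - (u + v) / q) *
          Complex.Gamma ((u + v) / q) / Complex.Gamma A))) := by
  have hσ : 0 < (u + v).re := by rw [Complex.add_re]; positivity
  have hm : Measurable fun S : ℝ => (snrWeight A c q S : ℂ) :=
    Complex.measurable_ofReal.comp (measurable_snrWeight A c q)
  rw [integral_comp_exp_add_exp hm u v, integral_beta_log hu hv,
    integral_snrWeight_exp hc hq hσ huv]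

theorem integrable_snrWeight_exp_add_exp {A c q : ℝ} (hc : 0 < c) (hq : 0 < q) {u v : ℂ}
    (hu : 0 < u.re) (hv : 0 < v.re) (huv : (u + v).re / q < A) :
    Integrable fun x : ℝ × ℝ => (snrWeight A c q (Real.exp x.1 + Real.exp x.2) : ℂ) *
        Complex.exp (u * x.1 + v * x.2) := by
  have hσ : 0 < (u + v).re := by rw [Complex.add_re]; positivity
  have hm : Measurable fun S : ℝ => (snrWeight A c q S : ℂ) :=
    Complex.measurable_ofReal.comp (measurable_snrWeight A c q)
  rw [← comp_ratioSumMap (fun S : ℝ => (snrWeight A c q S : ℂ)) u v,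
    measurePreserving_ratioSumMap.integrable_comp (aestronglyMeasurable_ratioSum hm u v),
    Measure.volume_eq_prod]
  exact (integrable_beta_log hu hv).mul_prod (integrable_snrWeight_exp hc hq hσ huv)

/-! ### Mellin inversion for the log-Gamma density -/

theorem norm_Gamma_le_Gamma_re {z : ℂ} (hz : 0 < z.re) : ‖Complex.Gamma z‖ ≤ Real.Gamma z.re := by
  have h : ((Real.Gamma z.re : ℝ) : ℂ) = ((∫ x : ℝ, Real.exp (z.re * x - Real.exp x) : ℝ) : ℂ) := by
    rw [← Complex.Gamma_ofReal, ← integral_cexp_sub_exp (s := (z.re : ℂ)) (by simpa using hz),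
      ← integral_complex_ofReal]
    congr 1
    funext x
    push_cast
    rfl
  rw [Complex.ofReal_inj.mp h, ← integral_cexp_sub_exp hz]
  refine (norm_integral_le_integral_norm _).trans (le_of_eq ?_)
  congr 1
  funext x
  rw [Complex.norm_exp]
  simp [Complex.exp_ofReal_re]

theorem continuous_Gamma_vertical {σ : ℝ} (hσ : 0 < σ) :
    Continuous fun τ : ℝ => Complex.Gamma (σ + τ * Complex.I) := by
  rw [continuous_iff_continuousAt]
  intro τ
  have h : ContinuousAt Complex.Gamma (σ + τ * Complex.I) := by
    refine (Complex.differentiableAt_Gamma _ fun n hn => ?_).continuousAt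
    have := congrArg Complex.re hn
    simp at this
    have h2 : (0 : ℝ) ≤ n := n.cast_nonneg
    linarith
  exact ContinuousAt.comp (f := fun τ : ℝ => (σ + τ * Complex.I : ℂ)) h (by fun_prop)

/-- `Γ` is integrable on vertical lines in the right half plane. Two steps of the functional
equation give `|Γ(z)| ≤ Γ(Re z + 2) / |z (z + 1)|`, which is decay enough. -/
theorem integrable_Gamma_vertical {σ : ℝ} (hσ : 0 < σ) :
    Integrable fun τ : ℝ => Complex.Gamma (σ + τ * Complex.I) := by
  set c := min (σ ^ 2) 1 with hc
  have hc0 : 0 < c := lt_min (by positivity) one_pos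
  refine (integrable_inv_one_add_sq.const_mul (Real.Gamma (σ + 2) / c)).mono'
    (continuous_Gamma_vertical hσ).aestronglyMeasurable (Eventually.of_forall fun τ => ?_)
  set z : ℂ := σ + τ * Complex.I with hz
  have hre : z.re = σ := by simp [hz]
  have him : z.im = τ := by simp [hz]
  have hz0 : z ≠ 0 := fun h => by rw [h] at hre; simp at hre; linarith
  have hz1 : z + 1 ≠ 0 := fun h => by
    have := congrArg Complex.re h
    simp [hre] at this
    linarith
  have h1 : Complex.Gamma (z + 1 + 1) = (z + 1) * (z * Complex.Gamma z) := by
    rw [Complex.Gamma_add_one _ hz1, Complex.Gamma_add_one _ hz0]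
  have h2 : ‖z + 1‖ * (‖z‖ * ‖Complex.Gamma z‖) ≤ Real.Gamma (σ + 2) := by
    rw [← norm_mul, ← norm_mul, ← h1]
    refine (norm_Gamma_le_Gamma_re (by simp [hre]; linarith)).trans (le_of_eq ?_)
    simp only [Complex.add_re, hre, Complex.one_re]
    ring_nf
  have h3 : ‖z‖ ≤ ‖z + 1‖ := by
    rw [← sq_le_sq₀ (norm_nonneg _) (norm_nonneg _), ← Complex.normSq_eq_norm_sq,
      ← Complex.normSq_eq_norm_sq, Complex.normSq_apply, Complex.normSq_apply]
    simp only [Complex.add_re, hre, him, Complex.one_re, Complex.add_im, Complex.one_im]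
    nlinarith
  have h4 : c * (1 + τ ^ 2) ≤ ‖z‖ * ‖z‖ := by
    rw [← sq, ← Complex.normSq_eq_norm_sq, Complex.normSq_apply, hre, him]
    have := min_le_left (σ ^ 2) 1
    have := min_le_right (σ ^ 2) 1
    nlinarith [sq_nonneg τ]
  rw [div_mul_eq_mul_div, ← div_eq_mul_inv, div_div, le_div_iff₀ (by positivity)]
  calc ‖Complex.Gamma z‖ * ((1 + τ ^ 2) * c) ≤ ‖Complex.Gamma z‖ * (‖z‖ * ‖z‖) := by
        exact mul_le_mul_of_nonneg_left (by linarith) (norm_nonneg _)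
    _ ≤ ‖Complex.Gamma z‖ * (‖z‖ * ‖z + 1‖) := by gcongr
    _ = ‖z + 1‖ * (‖z‖ * ‖Complex.Gamma z‖) := by ring
    _ ≤ _ := h2

theorem integrable_Gamma_affine {a m κ : ℝ} (ha : a ≠ 0) (h : 0 < m + a * κ) :
    Integrable fun τ : ℝ => Complex.Gamma (m + a * (κ + τ * Complex.I)) := by
  refine ((integrable_Gamma_vertical h).comp_mul_left' ha).congr (Eventually.of_forall fun τ => ?_)
  simp only
  congr 1
  push_cast
  ring

theorem exp_neg_eq_integral_Gamma {σ x : ℝ} (hσ : 0 < σ) (hx : 0 < x) :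
    ((Real.exp (-x) : ℝ) : ℂ) = 1 / (2 * Real.pi) *
      ∫ τ : ℝ, (x : ℂ) ^ (-(σ + τ * Complex.I)) * Complex.Gamma (σ + τ * Complex.I) := by
  have hG : ∀ τ : ℝ, mellin (fun x => ((Real.exp (-x) : ℝ) : ℂ)) (σ + τ * Complex.I) =
      Complex.Gamma (σ + τ * Complex.I) := fun τ => by
    rw [Complex.Gamma_eq_integral (by simpa using hσ), Complex.GammaIntegral_eq_mellin]
  have hconv : MellinConvergent (fun x => ((Real.exp (-x) : ℝ) : ℂ)) (σ : ℂ) := by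
    have := Complex.GammaIntegral_convergent (s := σ) (by simpa using hσ)
    refine this.congr_fun (fun x _ => ?_) measurableSet_Ioi
    simp only [smul_eq_mul, mul_comm]
  have hvert : Complex.VerticalIntegrable (mellin fun x => ((Real.exp (-x) : ℝ) : ℂ)) σ := by
    unfold Complex.VerticalIntegrable
    simp_rw [hG]
    exact integrable_Gamma_vertical hσ
  have h := mellinInv_mellin_eq σ _ hx hconv hvert (by fun_prop)
  rw [← h, mellinInv]
  simp_rw [hG, smul_eq_mul]
  rw [Complex.real_smul]
  push_cast
  rfl

/-- The density of `a log G`, where `G` has the Gamma distribution with shape `m` and rate `1`; the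
scale `a` may be negative, but not `0`. -/
noncomputable def logGammaPDF (a m x : ℝ) : ℝ :=
  Real.exp (m * (x / a) - Real.exp (x / a)) / (|a| * Real.Gamma m)

theorem measurable_logGammaPDF (a m : ℝ) : Measurable (logGammaPDF a m) := by
  unfold logGammaPDF
  fun_prop

theorem logGammaPDF_nonneg (a : ℝ) {m : ℝ} (hm : 0 < m) (x : ℝ) : 0 ≤ logGammaPDF a m x := by
  unfold logGammaPDF
  have := Real.Gamma_pos_of_pos hm
  positivity

theorem logGammaPDF_mul_cexp {a m : ℝ} (ha : a ≠ 0) (s : ℂ) (x : ℝ) :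
    (logGammaPDF a m x : ℂ) * Complex.exp (s * x) =
      (|a| * Real.Gamma m : ℝ)⁻¹ *
        Complex.exp ((m + a * s) * ((a⁻¹ * x : ℝ) : ℂ) - Real.exp (a⁻¹ * x)) := by
  have hac : (a : ℂ) ≠ 0 := by exact_mod_cast ha
  rw [logGammaPDF, div_eq_inv_mul, Complex.ofReal_mul, Complex.ofReal_exp, mul_assoc,
    ← Complex.exp_add, Complex.ofReal_inv]
  congr 2
  rw [show x / a = a⁻¹ * x by ring]
  push_cast
  field_simp
  ring

theorem integrable_logGammaPDF_mul_cexp {a m : ℝ} (ha : a ≠ 0) {s : ℂ}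
    (hs : 0 < m + a * s.re) :
    Integrable fun x : ℝ => (logGammaPDF a m x : ℂ) * Complex.exp (s * x) := by
  simp_rw [logGammaPDF_mul_cexp ha]
  have h : 0 < ((m : ℂ) + a * s).re := by simpa using hs
  exact ((integrable_cexp_sub_exp h).comp_mul_left' (inv_ne_zero ha)).const_mul _

theorem integral_logGammaPDF_mul_cexp {a m : ℝ} (ha : a ≠ 0) {s : ℂ} (hs : 0 < m + a * s.re) :
    ∫ x : ℝ, (logGammaPDF a m x : ℂ) * Complex.exp (s * x) =
      Complex.Gamma (m + a * s) / Real.Gamma m := by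
  simp_rw [logGammaPDF_mul_cexp ha]
  have h : 0 < ((m : ℂ) + a * s).re := by simpa using hs
  have h3 := Measure.integral_comp_mul_left
    (fun w : ℝ => Complex.exp ((m + a * s) * w - Real.exp w)) a⁻¹
  rw [inv_inv, integral_cexp_sub_exp h, Complex.real_smul] at h3
  rw [integral_const_mul, h3]
  have h4 : ((|a| : ℝ) : ℂ) ≠ 0 := by exact_mod_cast (abs_pos.mpr ha).ne'
  push_cast
  field_simp

theorem integrable_logGammaPDF {a m : ℝ} (ha : a ≠ 0) (hm : 0 < m) :
    Integrable (logGammaPDF a m) := by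
  have h := (integrable_logGammaPDF_mul_cexp ha (s := 0) (m := m) (by simpa using hm)).re
  simpa using h

/-- Mellin inversion for the log-Gamma density. The Mellin variable is `2 s`, as in the H-function,
whose kernel contains `Γ(1/2 - s) Γ(-s)`, a multiple of `Γ(-2 s)`. -/
theorem logGammaPDF_eq_integral_Gamma {a m κ : ℝ} (ha : a ≠ 0) (h : 0 < m + 2 * a * κ) (x : ℝ) :
    (logGammaPDF a m x : ℂ) = (Real.pi * Real.Gamma m : ℝ)⁻¹ *
      ∫ τ : ℝ, Complex.Gamma (m + (2 * a : ℝ) * (κ + τ * Complex.I)) *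
        Complex.exp (-2 * (κ + τ * Complex.I) * x) := by
  have hac : (a : ℂ) ≠ 0 := by exact_mod_cast ha
  have h2a : 2 * a ≠ 0 := mul_ne_zero two_ne_zero ha
  have h1 := exp_neg_eq_integral_Gamma h (Real.exp_pos (x / a))
  set g : ℝ → ℂ := fun τ => ((Real.exp (x / a) : ℝ) : ℂ) ^ (-(((m + 2 * a * κ : ℝ) : ℂ)
    + τ * Complex.I)) * Complex.Gamma (((m + 2 * a * κ : ℝ) : ℂ) + τ * Complex.I) with hg
  have h3 := Measure.integral_comp_mul_left g (2 * a)
  have h5 : (|2 * a| : ℝ) ≠ 0 := (abs_pos.mpr h2a).ne'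
  have h4 : ∫ τ, g τ = ((|2 * a| : ℝ) : ℂ) * ∫ τ, g (2 * a * τ) := by
    rw [h3, Complex.real_smul, ← mul_assoc, ← Complex.ofReal_mul, abs_inv, mul_inv_cancel₀ h5,
      Complex.ofReal_one, one_mul]
  have h6 : ∀ τ : ℝ, g (2 * a * τ) = Complex.exp (-(m * (x / a) : ℝ)) *
      (Complex.Gamma (m + (2 * a : ℝ) * (κ + τ * Complex.I)) *
        Complex.exp (-2 * (κ + τ * Complex.I) * x)) := by
    intro τ
    have e1 : ((m + 2 * a * κ : ℝ) : ℂ) + (2 * a * τ : ℝ) * Complex.I =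
        m + (2 * a : ℝ) * (κ + τ * Complex.I) := by push_cast; ring
    simp only [hg]
    rw [e1, Complex.cpow_def_of_ne_zero (by exact_mod_cast (Real.exp_pos _).ne'),
      ← Complex.ofReal_log (Real.exp_pos _).le, Real.log_exp, mul_left_comm, ← Complex.exp_add,
      mul_comm]
    congr 2
    push_cast
    field_simp
    ring
  simp_rw [h6] at h4
  rw [integral_const_mul] at h4
  rw [h4] at h1
  rw [logGammaPDF, sub_eq_add_neg, Real.exp_add, Complex.ofReal_div, Complex.ofReal_mul, h1]
  have h7 : Complex.exp (-(m * (x / a) : ℝ)) = ((Real.exp (m * (x / a)) : ℝ) : ℂ)⁻¹ := by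
    rw [Complex.exp_neg, Complex.ofReal_exp]
  rw [h7, abs_mul, abs_two]
  have h8 : ((Real.exp (m * (x / a)) : ℝ) : ℂ) ≠ 0 := by exact_mod_cast (Real.exp_pos _).ne'
  have h9 : ((|a| : ℝ) : ℂ) ≠ 0 := by exact_mod_cast (abs_pos.mpr ha).ne'
  have h10 : (Real.pi : ℂ) ≠ 0 := by exact_mod_cast Real.pi_ne_zero
  generalize (∫ τ : ℝ, Complex.Gamma (m + (2 * a : ℝ) * (κ + τ * Complex.I)) *
    Complex.exp (-2 * (κ + τ * Complex.I) * x)) = J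
  push_cast
  field_simp

/-! ### Mellin–Barnes representations -/

/-- Fubini's theorem for a kernel dominated uniformly in its first variable. -/
theorem integral_mul_integral_of_dominated {α β : Type*} [MeasurableSpace α] [MeasurableSpace β]
    {μ : Measure α} {ν : Measure β} [SFinite μ] [SFinite ν] {φ : α → ℂ} (hφ : Integrable φ μ)
    {k : α → β → ℂ} (hk : Measurable (Function.uncurry k)) {K : β → ℝ} (hK : Integrable K ν)
    (hb : ∀ a b, ‖k a b‖ ≤ K b) :
    Integrable (fun a => φ a * ∫ b, k a b ∂ν) μ ∧
      ∫ b, ∫ a, φ a * k a b ∂μ ∂ν = ∫ a, φ a * ∫ b, k a b ∂ν ∂μ := by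
  have hint : Integrable (fun z : α × β => φ z.1 * k z.1 z.2) (μ.prod ν) := by
    refine (hφ.norm.mul_prod hK).mono' ?_ (Eventually.of_forall fun z => ?_)
    · exact hφ.aestronglyMeasurable.comp_fst.mul hk.aestronglyMeasurable
    · rw [norm_mul]
      exact mul_le_mul_of_nonneg_left (hb _ _) (norm_nonneg _)
  constructor
  · have := hint.integral_prod_left
    simpa only [integral_const_mul] using this
  · rw [integral_integral_swap]
    · simp only [integral_const_mul]
    · exact hint.swap

/-- The density of `log (R ^ p)` for a GSNM envelope `R`: up to the shift `δ`, `log (R ^ p)` is the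
sum of independent multiples of the logarithms of two Gamma variables of shapes `m` and `ms`, one
for the multipath fading (with `a = p / β`) and one for the average power. -/
noncomputable def logGSNMPDF (m a ms p δ u : ℝ) : ℝ :=
  ∫ v, logGammaPDF a m (u - v - δ) * logGammaPDF (p / 2) ms v

/-- The kernel of one branch, `Γ(m + 2 a s) Γ(ms + p s) e ^ (2 δ s)`: up to a constant, the moment
of order `2 s` of `R ^ p`. -/
noncomputable def branchKernel (m a ms p δ : ℝ) (s : ℂ) : ℂ :=
  Complex.Gamma (m + (2 * a : ℝ) * s) * Complex.Gamma (ms + p * s) * Complex.exp (2 * s * δ)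

theorem logGSNMPDF_nonneg (a p δ : ℝ) {m ms : ℝ} (hm : 0 < m) (hms : 0 < ms) (u : ℝ) :
    0 ≤ logGSNMPDF m a ms p δ u :=
  integral_nonneg fun _ => mul_nonneg (logGammaPDF_nonneg _ hm _) (logGammaPDF_nonneg _ hms _)

/-- The log-Gamma density is bounded: its Fourier transform is integrable. -/
theorem exists_logGammaPDF_le {a m : ℝ} (ha : a ≠ 0) (hm : 0 < m) :
    ∃ M, ∀ x, logGammaPDF a m x ≤ M := by
  refine ⟨‖((Real.pi * Real.Gamma m : ℝ) : ℂ)⁻¹‖ *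
    ∫ τ : ℝ, ‖Complex.Gamma (m + (2 * a : ℝ) * ((0 : ℝ) + τ * Complex.I))‖, fun x => ?_⟩
  -- the inversion formula on the imaginary axis, where the exponential factor has modulus one
  have h := logGammaPDF_eq_integral_Gamma (κ := 0) ha (by simpa using hm) x
  have h1 : logGammaPDF a m x = ‖(logGammaPDF a m x : ℂ)‖ := by
    rw [Complex.norm_real, Real.norm_of_nonneg (logGammaPDF_nonneg a hm x)]
  rw [h1, h, norm_mul, Complex.ofReal_inv]
  refine mul_le_mul_of_nonneg_left ((norm_integral_le_integral_norm _).trans (le_of_eq ?_))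
    (norm_nonneg _)
  congr 1
  funext τ
  rw [norm_mul, Complex.norm_exp]
  simp

theorem integrable_logGSNMPDF_integrand {a m p ms : ℝ} (ha : a ≠ 0) (hm : 0 < m) (hp : p ≠ 0)
    (hms : 0 < ms) (δ u : ℝ) :
    Integrable fun v => logGammaPDF a m (u - v - δ) * logGammaPDF (p / 2) ms v := by
  obtain ⟨M, hM⟩ := exists_logGammaPDF_le ha hm
  refine (integrable_logGammaPDF (div_ne_zero hp two_ne_zero) hms).bdd_mul (c := M) ?_
    (Eventually.of_forall fun v => ?_)
  · exact ((measurable_logGammaPDF a m).comp (by fun_prop)).aestronglyMeasurable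
  · rw [Real.norm_of_nonneg (logGammaPDF_nonneg a hm _)]
    exact hM _

theorem measurable_logGSNMPDF (m a ms p δ : ℝ) : Measurable (logGSNMPDF m a ms p δ) := by
  refine StronglyMeasurable.measurable (StronglyMeasurable.integral_prod_right
    (f := fun u v => logGammaPDF a m (u - v - δ) * logGammaPDF (p / 2) ms v) ?_)
  refine Measurable.stronglyMeasurable ?_
  have h1 := measurable_logGammaPDF a m
  have h2 := measurable_logGammaPDF (p / 2) ms
  unfold Function.uncurry
  fun_prop

/-- Mellin inversion for the density of `log (R ^ p)`. -/
theorem logGSNMPDF_eq_integral {m a ms p κ : ℝ} (δ : ℝ) (ha : a ≠ 0) (hp : p ≠ 0)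
    (hms : 0 < ms) (h1 : 0 < m + 2 * a * κ) (h2 : 0 < ms + p * κ) :
    Integrable (fun τ : ℝ => branchKernel m a ms p δ (κ + τ * Complex.I)) ∧
    ∀ u : ℝ, (logGSNMPDF m a ms p δ u : ℂ) =
      (Real.pi * Real.Gamma m * Real.Gamma ms : ℝ)⁻¹ *
        ∫ τ : ℝ, branchKernel m a ms p δ (κ + τ * Complex.I) *
          Complex.exp (-2 * (κ + τ * Complex.I) * u) := by
  have hp2 : p / 2 ≠ 0 := div_ne_zero hp two_ne_zero
  have hG := integrable_Gamma_affine (m := m) (κ := κ) (mul_ne_zero two_ne_zero ha) h1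
  -- the kernel whose integral over `v` is the factor of the Gamma shadowing
  set k : ℝ → ℝ → ℝ → ℂ := fun u τ v => (logGammaPDF (p / 2) ms v : ℂ) *
    Complex.exp (-2 * (κ + τ * Complex.I) * ((u - v - δ : ℝ) : ℂ)) with hk
  have hk' : ∀ u τ v, k u τ v = Complex.exp (-2 * (κ + τ * Complex.I) * (u - δ)) *
      ((logGammaPDF (p / 2) ms v : ℂ) * Complex.exp (2 * (κ + τ * Complex.I) * v)) := by
    intro u τ v
    simp only [hk]
    rw [mul_left_comm, ← Complex.exp_add]
    congr 2
    push_cast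
    ring
  have hkm : ∀ u, Measurable (Function.uncurry (k u)) := fun u => by
    have := measurable_logGammaPDF (p / 2) ms
    simp only [hk]
    unfold Function.uncurry
    fun_prop
  have hre : ∀ τ : ℝ, 0 < ms + p / 2 * (2 * ((κ : ℂ) + τ * Complex.I)).re := by
    intro τ
    have e : (2 * ((κ : ℂ) + τ * Complex.I)).re = 2 * κ := by simp
    rw [e]
    linarith
  have hkint : ∀ u (τ : ℝ), ∫ v, k u τ v = (Real.Gamma ms : ℝ)⁻¹ *
      (Complex.Gamma (ms + p * (κ + τ * Complex.I)) *
        Complex.exp (2 * (κ + τ * Complex.I) * δ) *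
          Complex.exp (-2 * (κ + τ * Complex.I) * u)) := by
    intro u τ
    simp_rw [hk']
    rw [integral_const_mul, integral_logGammaPDF_mul_cexp hp2 (hre τ), mul_assoc (Complex.Gamma _),
      ← Complex.exp_add, mul_comm, div_eq_inv_mul, mul_assoc]
    have e1 : (ms : ℂ) + (p / 2 : ℝ) * (2 * (κ + τ * Complex.I)) =
        ms + p * (κ + τ * Complex.I) := by push_cast; ring
    have e2 : -2 * ((κ : ℂ) + τ * Complex.I) * (u - δ) =
        2 * (κ + τ * Complex.I) * δ + -2 * (κ + τ * Complex.I) * u := by ring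
    rw [e1, e2, Complex.ofReal_inv]
  have hK : ∀ u, Integrable fun v => ‖k u 0 v‖ := by
    intro u
    have := (integrable_logGammaPDF_mul_cexp hp2 (hre 0)).const_mul
      (Complex.exp (-2 * (κ + (0 : ℝ) * Complex.I) * (u - δ)))
    simp_rw [hk']
    exact this.norm
  have hbound : ∀ u τ v, ‖k u τ v‖ ≤ ‖k u 0 v‖ := by
    intro u τ v
    simp only [hk]
    rw [norm_mul, norm_mul, Complex.norm_exp, Complex.norm_exp]
    simp
  have main := fun u => integral_mul_integral_of_dominated hG (hkm u) (hK u) (hbound u)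
  simp_rw [hkint] at main
  refine ⟨?_, fun u => ?_⟩
  · have hG0 : ((Real.Gamma ms : ℝ) : ℂ) ≠ 0 := by
      exact_mod_cast (Real.Gamma_pos_of_pos hms).ne'
    refine ((main 0).1.const_mul (Real.Gamma ms : ℂ)).congr (Eventually.of_forall fun τ => ?_)
    simp only [Complex.ofReal_zero, mul_zero, Complex.exp_zero, mul_one, branchKernel]
    rw [mul_left_comm, Complex.ofReal_inv, mul_inv_cancel_left₀ hG0]
    ring
  · rw [logGSNMPDF, ← integral_complex_ofReal]
    have e1 : ∀ v : ℝ, ((logGammaPDF a m (u - v - δ) * logGammaPDF (p / 2) ms v : ℝ) : ℂ) =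
        (Real.pi * Real.Gamma m : ℝ)⁻¹ *
          ∫ τ : ℝ, Complex.Gamma (m + (2 * a : ℝ) * (κ + τ * Complex.I)) * k u τ v := by
      intro v
      rw [Complex.ofReal_mul, logGammaPDF_eq_integral_Gamma ha h1, mul_assoc,
        ← integral_mul_const]
      congr 2
      funext τ
      simp only [hk]
      ring
    simp_rw [e1]
    rw [integral_const_mul, (main u).2, ← integral_const_mul, ← integral_const_mul]
    congr 1
    funext τ
    rw [branchKernel]
    push_cast
    rw [mul_inv, mul_inv, mul_inv]
    ring

/-- Parseval's identity behind the closed form: the expectation of `(1 + c (X + Y) ^ q) ^ (-A)`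
against densities given by absolutely convergent inverse Mellin transforms. -/
theorem integral_snrWeight_mul_density {A c q κ₁ κ₂ C₁ C₂ : ℝ} (hc : 0 < c) (hq : 0 < q)
    (hκ₁ : κ₁ < 0) (hκ₂ : κ₂ < 0) (hA : 0 < A + 2 / q * κ₁ + 2 / q * κ₂)
    {g₁ g₂ : ℝ → ℝ} {ψ₁ ψ₂ : ℝ → ℂ} (hψ₁ : Integrable ψ₁) (hψ₂ : Integrable ψ₂)
    (h₁ : ∀ u : ℝ, (g₁ u : ℂ) = C₁ * ∫ τ : ℝ, ψ₁ τ * Complex.exp (-2 * (κ₁ + τ * Complex.I) * u))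
    (h₂ : ∀ u : ℝ, (g₂ u : ℂ) = C₂ * ∫ τ : ℝ, ψ₂ τ * Complex.exp (-2 * (κ₂ + τ * Complex.I) * u)) :
    Integrable (fun τ : ℝ × ℝ => ψ₁ τ.1 * ψ₂ τ.2 *
      ∫ x : ℝ × ℝ, (snrWeight A c q (Real.exp x.1 + Real.exp x.2) : ℂ) *
        Complex.exp (-2 * (κ₁ + τ.1 * Complex.I) * x.1 + -2 * (κ₂ + τ.2 * Complex.I) * x.2)) ∧
    ((∫ x : ℝ × ℝ, snrWeight A c q (Real.exp x.1 + Real.exp x.2) * (g₁ x.1 * g₂ x.2) : ℝ) : ℂ) =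
      C₁ * C₂ * ∫ τ : ℝ × ℝ, ψ₁ τ.1 * ψ₂ τ.2 *
        ∫ x : ℝ × ℝ, (snrWeight A c q (Real.exp x.1 + Real.exp x.2) : ℂ) *
          Complex.exp (-2 * (κ₁ + τ.1 * Complex.I) * x.1 + -2 * (κ₂ + τ.2 * Complex.I) * x.2) := by
  set k : ℝ × ℝ → ℝ × ℝ → ℂ := fun τ x =>
    (snrWeight A c q (Real.exp x.1 + Real.exp x.2) : ℂ) *
      Complex.exp (-2 * (κ₁ + τ.1 * Complex.I) * x.1 + -2 * (κ₂ + τ.2 * Complex.I) * x.2) with hk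
  have hkm : Measurable (Function.uncurry k) := by
    have := measurable_snrWeight A c q
    simp only [hk]
    unfold Function.uncurry
    fun_prop
  have hK : Integrable fun x => ‖k 0 x‖ := by
    refine (integrable_snrWeight_exp_add_exp hc hq ?_ ?_ ?_).norm
    · simp; linarith
    · simp; linarith
    · have e : ((-2 * ((κ₁ : ℂ) + ((0 : ℝ × ℝ).1 : ℝ) * Complex.I)) +
          (-2 * ((κ₂ : ℂ) + ((0 : ℝ × ℝ).2 : ℝ) * Complex.I))).re = -2 * κ₁ + -2 * κ₂ := by simp
      rw [e, div_lt_iff₀ hq]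
      have : A + 2 / q * κ₁ + 2 / q * κ₂ = (A * q - (-2 * κ₁ + -2 * κ₂)) / q := by
        field_simp; ring
      rw [this, div_pos_iff_of_pos_right hq] at hA
      linarith
  have hb : ∀ τ x, ‖k τ x‖ ≤ ‖k 0 x‖ := by
    intro τ x
    simp only [hk]
    rw [norm_mul, norm_mul, Complex.norm_exp, Complex.norm_exp]
    simp
  have main := integral_mul_integral_of_dominated (hψ₁.mul_prod hψ₂) hkm hK hb
  refine ⟨main.1, ?_⟩
  rw [Measure.volume_eq_prod] at main ⊢
  rw [← main.2, ← integral_complex_ofReal, ← integral_const_mul]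
  congr 1
  funext x
  rw [Complex.ofReal_mul, Complex.ofReal_mul, h₁, h₂, mul_mul_mul_comm, ← integral_prod_mul,
    mul_left_comm, ← integral_const_mul]
  congr 2
  funext τ
  simp only [hk]
  rw [Complex.exp_add]
  ring

/-! ### The GSNM law in logarithmic coordinates -/

theorem image_mul_exp_univ {k a : ℝ} (hk : 0 < k) (ha : a ≠ 0) :
    (fun x => k * Real.exp (a * x)) '' Set.univ = Set.Ioi 0 := by
  ext y
  simp only [Set.image_univ, Set.mem_range, Set.mem_Ioi]
  constructor
  · rintro ⟨x, rfl⟩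
    positivity
  · intro hy
    refine ⟨Real.log (y / k) / a, ?_⟩
    rw [mul_div_cancel₀ _ ha, Real.exp_log (by positivity), mul_div_cancel₀ _ hk.ne']

theorem lintegral_Ioi_eq_lintegral_exp {k a : ℝ} (hk : 0 < k) (ha : a ≠ 0) (g : ℝ → ENNReal) :
    ∫⁻ r in Set.Ioi 0, g r =
      ∫⁻ x, ENNReal.ofReal (k * |a| * Real.exp (a * x)) * g (k * Real.exp (a * x)) := by
  have hd : ∀ x ∈ Set.univ, HasDerivWithinAt (fun x => k * Real.exp (a * x))
      (k * (Real.exp (a * x) * a)) Set.univ x := fun x _ => by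
    have h := (((hasDerivAt_id x).const_mul a).exp.const_mul k).hasDerivWithinAt (s := Set.univ)
    simpa using h
  have hinj : Set.InjOn (fun x => k * Real.exp (a * x)) Set.univ := fun x _ y _ hxy =>
    mul_left_cancel₀ ha (Real.exp_injective (mul_left_cancel₀ hk.ne' hxy))
  rw [← image_mul_exp_univ hk ha,
    lintegral_image_eq_lintegral_abs_deriv_mul MeasurableSet.univ hd hinj, Measure.restrict_univ]
  refine lintegral_congr fun x => ?_
  rw [abs_mul, abs_mul, abs_of_pos hk, abs_of_pos (Real.exp_pos _), mul_comm (Real.exp _),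
    mul_assoc]

theorem nakagamiB_pos {m β : ℝ} (hm : 0 < m) (hβ : 0 < β) : 0 < nakagamiB m β := by
  unfold nakagamiB
  exact div_pos (Real.Gamma_pos_of_pos (by positivity)) (Real.Gamma_pos_of_pos hm)

/-- Conditionally on the average power `w`, `log (R ^ p)` is a shifted log-Gamma variable. -/
theorem exp_mul_genNakagamiPDFReal {m β p w t : ℝ} (hβ : 0 < β) (hp : p ≠ 0)
    (hw : nakagamiB m β / w = Real.exp (-(2 / p) * t)) (u : ℝ) :
    |p⁻¹| * Real.exp (p⁻¹ * u) * genNakagamiPDFReal m β w (Real.exp (p⁻¹ * u)) =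
      logGammaPDF (p / β) m (u - t) := by
  rw [genNakagamiPDFReal, if_pos (Real.exp_pos _), hw, ← Real.exp_mul, ← Real.exp_mul,
    ← Real.exp_mul, ← Real.exp_mul, logGammaPDF]
  have e1 : Real.exp (-(2 / p) * t * (β / 2)) * Real.exp (p⁻¹ * u * β) =
      Real.exp ((u - t) / (p / β)) := by
    rw [← Real.exp_add]
    congr 1
    field_simp
    ring
  have e2 : Real.exp (p⁻¹ * u) *
      (Real.exp (-(2 / p) * t * (β * m / 2)) * Real.exp (p⁻¹ * u * (β * m - 1))) =
      Real.exp (m * ((u - t) / (p / β))) := by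
    rw [← Real.exp_add, ← Real.exp_add]
    congr 1
    field_simp
    ring
  rw [e1, sub_eq_add_neg _ (Real.exp _), Real.exp_add, ← e2, abs_div, abs_of_pos hβ, abs_inv]
  have : |p| ≠ 0 := abs_ne_zero.mpr hp
  by_cases hG : Real.Gamma m = 0
  · simp [hG]
  · field_simp

/-- In the coordinate `v`, the average power `(Ωs / ms) e ^ (2 v / p)` makes `v` a log-Gamma
variable. -/
theorem exp_mul_gammaPDFReal {ms Ωs p : ℝ} (hms : 0 < ms) (hΩs : 0 < Ωs) (hp : p ≠ 0) (v : ℝ) :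
    Ωs / ms * |2 / p| * Real.exp (2 / p * v) *
        gammaPDFReal ms (ms / Ωs) (Ωs / ms * Real.exp (2 / p * v)) =
      logGammaPDF (p / 2) ms v := by
  rw [gammaPDFReal, if_pos (by positivity), logGammaPDF]
  have e0 : ms / Ωs * (Ωs / ms * Real.exp (2 / p * v)) = Real.exp (v / (p / 2)) := by
    field_simp
  have e1 : Real.exp (2 / p * v) * ((ms / Ωs) ^ ms * (Ωs / ms * Real.exp (2 / p * v)) ^ (ms - 1)) =
      ms / Ωs * Real.exp (ms * (v / (p / 2))) := by
    rw [Real.mul_rpow (by positivity) (Real.exp_pos _).le, ← Real.exp_mul,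
      Real.rpow_sub_one (by positivity), ← inv_div ms Ωs, Real.inv_rpow (by positivity)]
    have h3 : (ms / Ωs) ^ ms ≠ 0 := by positivity
    have h4 : Real.exp (ms * (v / (p / 2))) =
        Real.exp (2 / p * v) * Real.exp (2 / p * v * (ms - 1)) := by
      rw [← Real.exp_add]
      congr 1
      field_simp
      ring
    rw [h4]
    field_simp
  rw [e0, sub_eq_add_neg (ms * (v / (p / 2))), Real.exp_add, abs_div, abs_div, abs_two]
  have hG := (Real.Gamma_pos_of_pos hms).ne'
  have : |p| ≠ 0 := abs_ne_zero.mpr hp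
  calc _ = Ωs / ms * (2 / |p|) / Real.Gamma ms * (Real.exp (2 / p * v) *
        ((ms / Ωs) ^ ms * (Ωs / ms * Real.exp (2 / p * v)) ^ (ms - 1))) *
          Real.exp (-Real.exp (v / (p / 2))) := by ring
    _ = _ := by rw [e1]; field_simp

theorem ofReal_mul_gsnmPDF {m β ms Ωs p δ : ℝ} (hm : 0 < m) (hβ : 0 < β) (hms : 0 < ms)
    (hΩs : 0 < Ωs) (hp : p ≠ 0) (hδ : Real.exp (2 / p * δ) = Ωs / (nakagamiB m β * ms)) (u : ℝ) :
    ENNReal.ofReal (|p⁻¹| * Real.exp (p⁻¹ * u)) * gsnmPDF m β ms Ωs (Real.exp (p⁻¹ * u)) =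
      ENNReal.ofReal (logGSNMPDF m (p / β) ms p δ u) := by
  have hb := nakagamiB_pos hm hβ
  have hp2 : 2 / p ≠ 0 := div_ne_zero two_ne_zero hp
  rw [gsnmPDF, lintegral_Ioi_eq_lintegral_exp (div_pos hΩs hms) hp2,
    ← lintegral_const_mul' _ _ ENNReal.ofReal_ne_top, logGSNMPDF,
    ofReal_integral_eq_lintegral_ofReal
      (integrable_logGSNMPDF_integrand (div_ne_zero hp hβ.ne') hm hp hms δ u)
      (Eventually.of_forall fun v =>
        mul_nonneg (logGammaPDF_nonneg _ hm _) (logGammaPDF_nonneg _ hms _))]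
  refine lintegral_congr fun v => ?_
  have hw : nakagamiB m β / (Ωs / ms * Real.exp (2 / p * v)) =
      Real.exp (-(2 / p) * (v + δ)) := by
    rw [show -(2 / p) * (v + δ) = -(2 / p * v) + -(2 / p * δ) by ring, Real.exp_add, Real.exp_neg,
      Real.exp_neg, hδ]
    field_simp
  rw [sub_sub, ← exp_mul_genNakagamiPDFReal hβ hp hw u, ← exp_mul_gammaPDFReal hms hΩs hp v,
    gammaPDF]
  have hg : 0 ≤ genNakagamiPDFReal m β (Ωs / ms * Real.exp (2 / p * v)) (Real.exp (p⁻¹ * u)) := by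
    rw [genNakagamiPDFReal, if_pos (Real.exp_pos _)]
    have := Real.Gamma_pos_of_pos hm
    positivity
  have key : ∀ {a b g c : ℝ}, 0 ≤ a → 0 ≤ b → 0 ≤ g →
      ENNReal.ofReal a * (ENNReal.ofReal b * (ENNReal.ofReal g * ENNReal.ofReal c)) =
        ENNReal.ofReal (a * g * (b * c)) := fun ha hb hg => by
    rw [ENNReal.ofReal_mul (mul_nonneg ha hg), ENNReal.ofReal_mul ha, ENNReal.ofReal_mul hb]
    ring
  exact key (by positivity) (by positivity) hg

theorem gsnmPDF_of_nonpos {m β ms Ωs r : ℝ} (hr : r ≤ 0) : gsnmPDF m β ms Ωs r = 0 := by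
  simp [gsnmPDF, genNakagamiPDFReal, not_lt.mpr hr]

/-- The law of a GSNM envelope `R` through the density of `log (R ^ p)`; this covers negative `p`,
for which `R` is a decreasing function of `log (R ^ p)`. -/
theorem gsnmMeasure_eq_map {m β ms Ωs p δ : ℝ} (hm : 0 < m) (hβ : 0 < β) (hms : 0 < ms)
    (hΩs : 0 < Ωs) (hp : p ≠ 0) (hδ : Real.exp (2 / p * δ) = Ωs / (nakagamiB m β * ms)) :
    gsnmMeasure m β ms Ωs =
      (volume.withDensity fun u => ENNReal.ofReal (logGSNMPDF m (p / β) ms p δ u)).map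
        fun u => Real.exp (p⁻¹ * u) := by
  have hme : Measurable fun u => Real.exp (p⁻¹ * u) := by fun_prop
  ext s hs
  rw [Measure.map_apply hme hs, withDensity_apply _ (hme hs), gsnmMeasure, withDensity_apply _ hs,
    ← lintegral_indicator hs, ← lintegral_indicator (hme hs)]
  have h0 : ∫⁻ r, s.indicator (gsnmPDF m β ms Ωs) r =
      ∫⁻ r in Set.Ioi 0, s.indicator (gsnmPDF m β ms Ωs) r := by
    rw [← lintegral_indicator measurableSet_Ioi]
    refine lintegral_congr fun r => ?_
    by_cases hr : 0 < r
    · rw [Set.indicator_of_mem (s := Set.Ioi 0) hr]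
    · rw [Set.indicator_of_notMem (s := Set.Ioi 0) hr]
      by_cases hrs : r ∈ s
      · rw [Set.indicator_of_mem hrs, gsnmPDF_of_nonpos (not_lt.mp hr)]
      · rw [Set.indicator_of_notMem hrs]
  rw [h0, lintegral_Ioi_eq_lintegral_exp one_pos (inv_ne_zero hp)]
  refine lintegral_congr fun u => ?_
  simp only [one_mul]
  by_cases hu : Real.exp (p⁻¹ * u) ∈ s
  · rw [Set.indicator_of_mem hu, ofReal_mul_gsnmPDF hm hβ hms hΩs hp hδ,
      Set.indicator_of_mem (s := (fun u => Real.exp (p⁻¹ * u)) ⁻¹' s) hu]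
  · rw [Set.indicator_of_notMem hu, mul_zero,
      Set.indicator_of_notMem (s := (fun u => Real.exp (p⁻¹ * u)) ⁻¹' s) hu]

theorem ae_gsnmMeasure_pos (m β ms Ωs : ℝ) : ∀ᵐ r ∂gsnmMeasure m β ms Ωs, 0 < r := by
  rw [ae_iff]
  have hs : {r : ℝ | ¬0 < r} = Set.Iic 0 := by ext r; simp
  rw [hs, gsnmMeasure, withDensity_apply _ measurableSet_Iic,
    setLIntegral_congr_fun measurableSet_Iic
      (fun r (hr : r ≤ 0) => gsnmPDF_of_nonpos (m := m) (β := β) (ms := ms) (Ωs := Ωs) hr),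
    lintegral_zero]

theorem integral_gsnmMeasure_prod {m β ms Ωs δ : Fin 2 → ℝ} {p : ℝ} (hm : ∀ l, 0 < m l)
    (hβ : ∀ l, 0 < β l) (hms : ∀ l, 0 < ms l) (hΩs : ∀ l, 0 < Ωs l) (hp : p ≠ 0)
    (hδ : ∀ l, Real.exp (2 / p * δ l) = Ωs l / (nakagamiB (m l) (β l) * ms l))
    {h : ℝ × ℝ → ℝ} (hh : Measurable h) :
    ∫ r, h r ∂(gsnmMeasure (m 0) (β 0) (ms 0) (Ωs 0)).prod
        (gsnmMeasure (m 1) (β 1) (ms 1) (Ωs 1)) =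
      ∫ x : ℝ × ℝ, h (Real.exp (p⁻¹ * x.1), Real.exp (p⁻¹ * x.2)) *
        (logGSNMPDF (m 0) (p / β 0) (ms 0) p (δ 0) x.1 *
          logGSNMPDF (m 1) (p / β 1) (ms 1) p (δ 1) x.2) := by
  have hme : Measurable fun u => Real.exp (p⁻¹ * u) := by fun_prop
  have hg : ∀ l, Measurable fun u =>
      ENNReal.ofReal (logGSNMPDF (m l) (p / β l) (ms l) p (δ l) u) :=
    fun l => (measurable_logGSNMPDF _ _ _ _ _).ennreal_ofReal
  have hg2 : Measurable fun z : ℝ × ℝ =>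
      ENNReal.ofReal (logGSNMPDF (m 0) (p / β 0) (ms 0) p (δ 0) z.1) *
        ENNReal.ofReal (logGSNMPDF (m 1) (p / β 1) (ms 1) p (δ 1) z.2) :=
    ((hg 0).comp measurable_fst).mul ((hg 1).comp measurable_snd)
  rw [gsnmMeasure_eq_map (hm 0) (hβ 0) (hms 0) (hΩs 0) hp (hδ 0),
    gsnmMeasure_eq_map (hm 1) (hβ 1) (hms 1) (hΩs 1) hp (hδ 1),
    Measure.map_prod_map _ _ hme hme, integral_map (by fun_prop) hh.aestronglyMeasurable,
    prod_withDensity (hg 0) (hg 1), integral_withDensity_eq_integral_toReal_smul hg2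
      (Eventually.of_forall fun x =>
        ENNReal.mul_lt_top ENNReal.ofReal_lt_top ENNReal.ofReal_lt_top),
    ← Measure.volume_eq_prod]
  congr 1
  funext x
  rw [ENNReal.toReal_mul, ENNReal.toReal_ofReal (logGSNMPDF_nonneg _ _ _ (hm 0) (hms 0) _),
    ENNReal.toReal_ofReal (logGSNMPDF_nonneg _ _ _ (hm 1) (hms 1) _), smul_eq_mul, mul_comm]
  rfl

/-! ### The Fox kernel as a Mellin transform -/

/-- The duplication formula merges `Γ(1/2 - s) Γ(-s)` into a multiple of `Γ(-2 s)`. -/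
theorem foxHKernel₁_dual (ms m p r : ℝ) (s : ℂ) :
    foxHKernel₁ 2 2 [(1 - ms, p), (1 - m, r)] [(1 / 2, 1), (0, 1)] s =
      2 * (Real.sqrt Real.pi : ℂ) * Complex.exp (2 * s * Real.log 2) * Complex.Gamma (-2 * s) *
        (Complex.Gamma (m + r * s) * Complex.Gamma (ms + p * s)) := by
  have h := Complex.Gamma_mul_Gamma_add_half (-s)
  have h2 : (2 : ℂ) ^ (1 - 2 * -s) = 2 * Complex.exp (2 * s * Real.log 2) := by
    rw [sub_eq_add_neg, Complex.cpow_add _ _ two_ne_zero, Complex.cpow_one,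
      Complex.cpow_def_of_ne_zero two_ne_zero, Complex.ofReal_log two_pos.le]
    congr 2
    push_cast
    ring
  rw [h2] at h
  have e1 : ((1 / 2 : ℝ) : ℂ) - ((1 : ℝ) : ℂ) * s = -s + 1 / 2 := by push_cast; ring
  have e2 : ((0 : ℝ) : ℂ) - ((1 : ℝ) : ℂ) * s = -s := by push_cast; ring
  have e3 : (1 : ℂ) - ((1 - ms : ℝ) : ℂ) + p * s = ms + p * s := by push_cast; ring
  have e4 : (1 : ℂ) - ((1 - m : ℝ) : ℂ) + r * s = m + r * s := by push_cast; ring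
  have e5 : 2 * -s = -2 * s := by ring
  rw [e5] at h
  simp only [foxHKernel₁, List.take_succ_cons, List.take_zero, List.map_cons, List.map_nil,
    List.prod_cons, List.prod_nil, List.drop_succ_cons, List.drop_zero, mul_one, div_one, e1, e2,
    e3, e4]
  rw [mul_comm (Complex.Gamma (-s + 1 / 2)), h]
  ring

theorem list_prod_map_range {M : Type*} [CommMonoid M] (f : ℕ → M) (n : ℕ) :
    ((List.range n).map f).prod = ∏ i ∈ Finset.range n, f i := by
  induction n with
  | zero => simp
  | succ n ih => rw [List.range_succ, List.map_append, List.prod_append, ih,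
      Finset.prod_range_succ]; simp

/-- The multiplication formula turns the `q - 1` Gamma functions in the denominator of the joint
kernel into `Γ(u + v) / Γ((u + v) / q)`, where `u = -2 s`, `v = -2 t`. -/
theorem foxHKernel₂_dual {q : ℕ} (hq : 1 ≤ q) (A : ℝ) {s t : ℂ} (h : (s + t).re < 0) :
    foxHKernel₂ 1 ((1 - A, 2 / (q : ℝ), 2 / (q : ℝ)) ::
        (List.range (q - 1)).map fun j => (((j : ℝ) + 1) / (q : ℝ), 2 / (q : ℝ), 2 / (q : ℝ)))
        [] s t =
      (((2 * Real.pi) ^ (((q : ℝ) - 1) / 2) : ℝ) : ℂ)⁻¹ * (Real.sqrt q : ℂ)⁻¹ *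
        Complex.exp (-2 * (s + t) * Real.log q) *
        (Complex.Gamma (A - (-2 * s + -2 * t) / (q : ℝ)) *
          Complex.Gamma ((-2 * s + -2 * t) / (q : ℝ)) / Complex.Gamma (-2 * s + -2 * t)) := by
  have hq0 : (0 : ℝ) < q := by exact_mod_cast hq
  have hqc : (q : ℂ) ≠ 0 := by exact_mod_cast hq0.ne'
  set z : ℂ := (-2 * s + -2 * t) / (q : ℝ) with hz
  have hqz : (q : ℂ) * z = -2 * s + -2 * t := by
    rw [hz, Complex.ofReal_natCast, mul_div_cancel₀ _ hqc]
  have hre : 0 < (-2 * s + -2 * t).re := by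
    have e : (-2 * s + -2 * t).re = -2 * (s + t).re := by simp; ring
    rw [e]; linarith
  have hzre : 0 < z.re := by rw [hz, Complex.div_ofReal_re]; positivity
  have hgauss := Complex.Gamma_multiplication hq z
  obtain ⟨n, rfl⟩ : ∃ n, q = n + 1 := ⟨q - 1, by omega⟩
  rw [Finset.prod_range_succ'] at hgauss
  simp only [Nat.cast_zero, zero_div, Complex.ofReal_zero, add_zero] at hgauss
  have hpow : ((n + 1 : ℕ) : ℂ) ^ (1 / 2 - ((n + 1 : ℕ) : ℂ) * z) =
      (Real.sqrt ((n + 1 : ℕ) : ℝ) : ℂ) *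
        Complex.exp (2 * (s + t) * Real.log ((n + 1 : ℕ) : ℝ)) := by
    rw [sub_eq_add_neg, Complex.cpow_add _ _ hqc, hqz, Complex.cpow_def_of_ne_zero hqc (-_),
      Real.sqrt_eq_rpow, Complex.ofReal_cpow hq0.le, Complex.ofReal_log hq0.le]
    push_cast
    congr 2
    ring
  have hnum : (1 : ℂ) - ((1 - A : ℝ) : ℂ) + ((2 / ((n + 1 : ℕ) : ℝ) : ℝ) : ℂ) * s +
      ((2 / ((n + 1 : ℕ) : ℝ) : ℝ) : ℂ) * t = A - z := by
    rw [hz]; push_cast; ring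
  have hden : ∀ j : ℕ, ((((j : ℝ) + 1) / ((n + 1 : ℕ) : ℝ) : ℝ) : ℂ) -
      ((2 / ((n + 1 : ℕ) : ℝ) : ℝ) : ℂ) * s - ((2 / ((n + 1 : ℕ) : ℝ) : ℝ) : ℂ) * t =
      z + ((((j + 1 : ℕ) : ℝ) / ((n + 1 : ℕ) : ℝ) : ℝ) : ℂ) := fun j => by
    rw [hz]; push_cast; ring
  simp only [foxHKernel₂, List.take_succ_cons, List.take_zero, List.map_cons, List.map_nil,
    List.prod_cons, List.prod_nil, List.drop_succ_cons, List.drop_zero, mul_one, List.map_map,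
    bind_pure_comp, List.map_eq_map, list_prod_map_range, Function.comp_apply, hnum, hden,
    add_tsub_cancel_right]
  set Q : ℂ := ∏ j ∈ Finset.range n,
    Complex.Gamma (z + ((((j + 1 : ℕ) : ℝ) / ((n + 1 : ℕ) : ℝ) : ℝ) : ℂ)) with hQ
  have hG2 := Complex.Gamma_ne_zero_of_re_pos hre
  have hQ0 : Q ≠ 0 := Finset.prod_ne_zero_iff.mpr fun j _ =>
    Complex.Gamma_ne_zero_of_re_pos (by rw [Complex.add_re, Complex.ofReal_re]; positivity)
  have hC0 : (((2 * Real.pi) ^ ((((n + 1 : ℕ) : ℝ) - 1) / 2) : ℝ) : ℂ) ≠ 0 := by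
    exact_mod_cast (Real.rpow_pos_of_pos (by positivity) _).ne'
  have hS0 : (Real.sqrt ((n + 1 : ℕ) : ℝ) : ℂ) ≠ 0 := by
    exact_mod_cast (Real.sqrt_pos.mpr hq0).ne'
  rw [hpow, hqz] at hgauss
  have hexp : Complex.exp (-2 * (s + t) * Real.log ((n + 1 : ℕ) : ℝ)) =
      (Complex.exp (2 * (s + t) * Real.log ((n + 1 : ℕ) : ℝ)))⁻¹ := by
    rw [← Complex.exp_neg]; congr 1; ring
  have hE0 := Complex.exp_ne_zero (2 * (s + t) * Real.log ((n + 1 : ℕ) : ℝ))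
  rw [hexp, div_eq_iff hQ0]
  generalize Complex.exp (2 * (s + t) * Real.log ((n + 1 : ℕ) : ℝ)) = E at *
  generalize (((2 * Real.pi) ^ ((((n + 1 : ℕ) : ℝ) - 1) / 2) : ℝ) : ℂ) = C at *
  generalize (Real.sqrt ((n + 1 : ℕ) : ℝ) : ℂ) = S at *
  generalize Complex.Gamma (-2 * s + -2 * t) = G2 at *
  generalize Complex.Gamma z = G1 at *
  field_simp
  linear_combination (-Complex.Gamma (A - z)) * hgauss

theorem admissible_dual_iff {q : ℕ} {p A : ℝ} {m β ms : Fin 2 → ℝ} {κ : ℝ × ℝ} :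
    (dualGSNMFoxHData q p A m β ms).Admissible κ ↔
      0 < A + 2 / q * κ.1 + 2 / q * κ.2 ∧
      (0 < ms 0 + p * κ.1 ∧ 0 < m 0 + 2 * p / β 0 * κ.1) ∧ κ.1 < 0 ∧
      (0 < ms 1 + p * κ.2 ∧ 0 < m 1 + 2 * p / β 1 * κ.2) ∧ κ.2 < 0 := by
  simp only [FoxHData.Admissible, dualGSNMFoxHData, List.take_succ_cons, List.take_zero,
    List.mem_cons, List.not_mem_nil, or_false, forall_eq_or_imp, forall_eq, sub_sub_cancel,
    one_mul, zero_sub, Left.neg_pos_iff]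
  constructor
  · rintro ⟨h1, h2, ⟨-, h3⟩, h4, -, h5⟩
    exact ⟨h1, h2, h3, h4, h5⟩
  · rintro ⟨h1, h2, h3, h4, h5⟩
    exact ⟨h1, h2, ⟨by linarith, h3⟩, h4, by linarith, h5⟩

/-- Lines just to the left of the imaginary axis are admissible. -/
theorem exists_admissible_dual (q : ℕ) (p : ℝ) {A : ℝ} (hA : 0 < A) {m : Fin 2 → ℝ}
    (β : Fin 2 → ℝ) {ms : Fin 2 → ℝ} (hm : ∀ l, 0 < m l) (hms : ∀ l, 0 < ms l) :
    ∃ κ, (dualGSNMFoxHData q p A m β ms).Admissible κ := by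
  have key : ∀ a b : ℝ, 0 < a → ∀ᶠ ε in 𝓝[<] (0 : ℝ), 0 < a + b * ε := fun a b ha => by
    refine Filter.Eventually.filter_mono nhdsWithin_le_nhds ?_
    refine (ContinuousAt.eventually_lt (by fun_prop) (by fun_prop) ?_)
    simpa using ha
  have hneg : ∀ᶠ ε in 𝓝[<] (0 : ℝ), ε < 0 := eventually_mem_nhdsWithin
  obtain ⟨ε, h1, h2, h3, h4, h5, h6⟩ := ((key A (2 / q + 2 / q) hA).and
    ((key (ms 0) p (hms 0)).and ((key (m 0) (2 * p / β 0) (hm 0)).and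
    ((key (ms 1) p (hms 1)).and ((key (m 1) (2 * p / β 1) (hm 1)).and hneg))))).exists
  exact ⟨(ε, ε), admissible_dual_iff.mpr ⟨by simp only; linarith, ⟨h2, h3⟩, h6, ⟨h4, h5⟩, h6⟩⟩

/-- On admissible lines the integrand of the H-function is, up to a constant, the product of the
branch kernels and of the Mellin transform of `(1 + c (X + Y) ^ q) ^ (-A)`. -/
theorem lineIntegrand_dual {q : ℕ} (hq : 1 ≤ q) {p A c : ℝ} (hA : 0 < A) (hc : 0 < c)
    {m β ms δ x : Fin 2 → ℝ}
    (hx : ∀ l, x l = Real.exp (2 * δ l) * (c ^ (2 / (q : ℝ)) * (q : ℝ) ^ 2 / 4))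
    {κ : ℝ × ℝ} (hκ : (dualGSNMFoxHData q p A m β ms).Admissible κ) (τ : ℝ × ℝ) :
    (dualGSNMFoxHData q p A m β ms).lineIntegrand (x 0) (x 1) κ τ =
      (4 * Real.pi * Real.sqrt q * Real.Gamma A / (2 * Real.pi) ^ (((q : ℝ) - 1) / 2) : ℝ) *
        (branchKernel (m 0) (p / β 0) (ms 0) p (δ 0) (κ.1 + τ.1 * Complex.I) *
          branchKernel (m 1) (p / β 1) (ms 1) p (δ 1) (κ.2 + τ.2 * Complex.I) *
          ∫ y : ℝ × ℝ, (snrWeight A c q (Real.exp y.1 + Real.exp y.2) : ℂ) *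
            Complex.exp (-2 * (κ.1 + τ.1 * Complex.I) * y.1 +
              -2 * (κ.2 + τ.2 * Complex.I) * y.2)) := by
  obtain ⟨h1, -, h3, -, h5⟩ := admissible_dual_iff.mp hκ
  have hq0 : (0 : ℝ) < q := by exact_mod_cast hq
  set s : ℂ := κ.1 + τ.1 * Complex.I with hs
  set t : ℂ := κ.2 + τ.2 * Complex.I with ht
  have hsre : s.re = κ.1 := by simp [hs]
  have htre : t.re = κ.2 := by simp [ht]
  have hu : 0 < (-2 * s).re := by simp [hsre]; linarith
  have hv : 0 < (-2 * t).re := by simp [htre]; linarith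
  have huv : (-2 * s + -2 * t).re / q < A := by
    have e : (-2 * s + -2 * t).re / q = -(2 / q * κ.1 + 2 / q * κ.2) := by
      simp [hsre, htre]; ring
    rw [e]; linarith
  have hst : (s + t).re < 0 := by rw [Complex.add_re, hsre, htre]; linarith
  have hpow : ∀ (l : Fin 2) (w : ℂ), (x l : ℂ) ^ w = Complex.exp (2 * w * δ l) *
      Complex.exp (2 * w / q * Real.log c) * Complex.exp (2 * w * Real.log q) *
      Complex.exp (-2 * w * Real.log 2) := by
    intro l w
    have hlog : Real.log (x l) = 2 * δ l + (2 / q * Real.log c + 2 * Real.log q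
        - 2 * Real.log 2) := by
      rw [hx, Real.log_mul (Real.exp_pos _).ne' (by positivity), Real.log_exp,
        Real.log_div (by positivity) (by norm_num), Real.log_mul (by positivity) (by positivity),
        Real.log_rpow hc, Real.log_pow, show (4 : ℝ) = 2 ^ 2 by norm_num, Real.log_pow]
      push_cast
      ring
    have hxpos : 0 < x l := by rw [hx]; positivity
    rw [Complex.cpow_def_of_ne_zero (by exact_mod_cast hxpos.ne'), ← Complex.ofReal_log hxpos.le,
      hlog, ← Complex.exp_add, ← Complex.exp_add, ← Complex.exp_add]
    congr 1
    push_cast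
    ring
  rw [integral_snrWeight_exp_add_exp hc hq0 hu hv huv, FoxHData.lineIntegrand,
    FoxHData.integrand]
  simp only [dualGSNMFoxHData]
  rw [← hs, ← ht, foxHKernel₁_dual, foxHKernel₁_dual, foxHKernel₂_dual hq A hst, hpow, hpow,
    branchKernel, branchKernel, mul_div_assoc 2 p, mul_div_assoc 2 p]
  have c1 : Complex.exp (-2 * (s + t) * Real.log q) =
      (Complex.exp (2 * s * Real.log q))⁻¹ * (Complex.exp (2 * t * Real.log q))⁻¹ := by
    rw [← Complex.exp_neg, ← Complex.exp_neg, ← Complex.exp_add]; congr 1; ring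
  have c2 : ∀ w : ℂ, Complex.exp (-2 * w * Real.log 2) =
      (Complex.exp (2 * w * Real.log 2))⁻¹ := fun w => by
    rw [← Complex.exp_neg]; congr 1; ring
  have c3 : Complex.exp (-((-2 * s + -2 * t) / (q : ℝ)) * Real.log c) =
      Complex.exp (2 * s / q * Real.log c) * Complex.exp (2 * t / q * Real.log c) := by
    rw [← Complex.exp_add]; congr 1; rw [Complex.ofReal_natCast]; ring
  have c4 : (Real.sqrt q : ℂ) * Real.sqrt q = ((q : ℝ) : ℂ) := by
    rw [← Complex.ofReal_mul, Real.mul_self_sqrt hq0.le]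
  have c5 : (Real.sqrt Real.pi : ℂ) * Real.sqrt Real.pi = Real.pi := by
    rw [← Complex.ofReal_mul, Real.mul_self_sqrt Real.pi_pos.le]
  have hS0 : (Real.sqrt q : ℂ) ≠ 0 := by exact_mod_cast (Real.sqrt_pos.mpr hq0).ne'
  have hA0 : Complex.Gamma A ≠ 0 := Complex.Gamma_ne_zero_of_re_pos (by simpa using hA)
  have hconst : ((4 * Real.pi * Real.sqrt q * Real.Gamma A /
      (2 * Real.pi) ^ (((q : ℝ) - 1) / 2) : ℝ) : ℂ) =
      4 * (Real.sqrt Real.pi * Real.sqrt Real.pi) * Real.sqrt q * Complex.Gamma A /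
        (((2 * Real.pi) ^ (((q : ℝ) - 1) / 2) : ℝ) : ℂ) := by
    rw [c5, Complex.ofReal_div, Complex.ofReal_mul, Complex.ofReal_mul, Complex.ofReal_mul,
      ← Complex.Gamma_ofReal A, Complex.ofReal_ofNat]
  rw [c1, c2, c2, c3, hconst]
  -- the remaining identity is one of field elements, isolated to keep it free of casts
  have key : ∀ C S Q W G E₁ E₂ E₃ E₄ D₁ D₂ F₁ F₂ G₁ G₂ G₃ G₄ G₅ G₆ G₇ G₈ G₉ : ℂ,
      S ≠ 0 → S * S = Q → G₉ ≠ 0 → E₁ ≠ 0 → E₂ ≠ 0 → E₃ ≠ 0 → E₄ ≠ 0 →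
      C⁻¹ * S⁻¹ * (E₁⁻¹ * E₂⁻¹) * (G₁ * G₂ / G) * (2 * W * E₃ * G₃ * (G₅ * G₆)) *
        (2 * W * E₄ * G₄ * (G₇ * G₈)) * (D₁ * F₁ * E₁ * E₃⁻¹) * (D₂ * F₂ * E₂ * E₄⁻¹) =
      4 * (W * W) * S * G₉ / C * (G₅ * G₆ * D₁ * (G₇ * G₈ * D₂) *
        (G₃ * G₄ / G * (F₁ * F₂ * (1 / Q * (G₁ * G₂ / G₉))))) := by
    rintro C S _ W G E₁ E₂ E₃ E₄ D₁ D₂ F₁ F₂ G₁ G₂ G₃ G₄ G₅ G₆ G₇ G₈ G₉ hS rfl h9 h1 h2 h3 h4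
    have hSS : S * (1 / (S * S)) = S⁻¹ := by field_simp
    calc _ = 4 * (W * W) * S⁻¹ * C⁻¹ * (G₅ * G₆ * D₁ * (G₇ * G₈ * D₂) * (G₃ * G₄ / G * (F₁ * F₂ *
          (G₁ * G₂)))) * (E₁ * E₁⁻¹) * (E₂ * E₂⁻¹) * (E₃ * E₃⁻¹) * (E₄ * E₄⁻¹) := by ring
      _ = 4 * (W * W) * (S * (1 / (S * S))) * C⁻¹ * (G₅ * G₆ * D₁ * (G₇ * G₈ * D₂) *
          (G₃ * G₄ / G * (F₁ * F₂ * (G₁ * G₂)))) * (G₉ * G₉⁻¹) := by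
        rw [mul_inv_cancel₀ h1, mul_inv_cancel₀ h2, mul_inv_cancel₀ h3, mul_inv_cancel₀ h4,
          mul_inv_cancel₀ h9, hSS]
        simp only [mul_one]
      _ = _ := by ring
  exact key _ _ _ _ _ _ _ _ _ _ _ _ _ _ _ _ _ _ _ _ _ _ hS0 c4 hA0
    (Complex.exp_ne_zero _) (Complex.exp_ne_zero _) (Complex.exp_ne_zero _) (Complex.exp_ne_zero _)

/-! ### The value of the H-function and the effective capacity -/

/-- On every pair of admissible lines the double Mellin–Barnes integral converges absolutely and
equals the expectation of `(1 + γ) ^ (-A)`, written in logarithmic coordinates, up to the constant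
of the closed form. -/
theorem mellinBarnes_dual {q : ℕ} (hq : 1 ≤ q) {p A c : ℝ} (hp : p ≠ 0) (hA : 0 < A) (hc : 0 < c)
    {m β ms δ x : Fin 2 → ℝ} (hm : ∀ l, 0 < m l) (hβ : ∀ l, 0 < β l) (hms : ∀ l, 0 < ms l)
    (hx : ∀ l, x l = Real.exp (2 * δ l) * (c ^ (2 / (q : ℝ)) * (q : ℝ) ^ 2 / 4))
    {κ : ℝ × ℝ} (hκ : (dualGSNMFoxHData q p A m β ms).Admissible κ) :
    Integrable ((dualGSNMFoxHData q p A m β ms).lineIntegrand (x 0) (x 1) κ) ∧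
    (dualGSNMFoxHData q p A m β ms).mellinBarnes (x 0) (x 1) κ =
      (((∫ y : ℝ × ℝ, snrWeight A c q (Real.exp y.1 + Real.exp y.2) *
        (logGSNMPDF (m 0) (p / β 0) (ms 0) p (δ 0) y.1 *
          logGSNMPDF (m 1) (p / β 1) (ms 1) p (δ 1) y.2)) /
        ((2 * Real.pi) ^ ((q : ℝ) / 2 - 1 / 2) /
          (Real.sqrt q * Real.Gamma (ms 0) * Real.Gamma (ms 1) * Real.Gamma (m 0) *
            Real.Gamma (m 1) * Real.Gamma A * Real.pi)) : ℝ) : ℂ) := by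
  obtain ⟨h1, ⟨h2, h2'⟩, h3, ⟨h4, h4'⟩, h5⟩ := admissible_dual_iff.mp hκ
  have hq0 : (0 : ℝ) < q := by exact_mod_cast hq
  have ha : ∀ l, p / β l ≠ 0 := fun l => div_ne_zero hp (hβ l).ne'
  rw [mul_div_assoc] at h2' h4'
  obtain ⟨hψ₁, hg₁⟩ := logGSNMPDF_eq_integral (δ 0) (ha 0) hp (hms 0) h2' h2
  obtain ⟨hψ₂, hg₂⟩ := logGSNMPDF_eq_integral (δ 1) (ha 1) hp (hms 1) h4' h4
  obtain ⟨hint, hE⟩ := integral_snrWeight_mul_density hc hq0 h3 h5 h1 hψ₁ hψ₂ hg₁ hg₂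
  have hline := lineIntegrand_dual hq hA hc hx hκ
  constructor
  · rw [show (dualGSNMFoxHData q p A m β ms).lineIntegrand (x 0) (x 1) κ = _ from funext hline]
    exact hint.const_mul _
  · rw [FoxHData.mellinBarnes]
    simp_rw [hline]
    rw [integral_mul_const, integral_const_mul]
    conv_rhs => rw [Complex.ofReal_div, hE]
    generalize (∫ τ : ℝ × ℝ, branchKernel (m 0) (p / β 0) (ms 0) p (δ 0) (κ.1 + τ.1 * Complex.I) *
          branchKernel (m 1) (p / β 1) (ms 1) p (δ 1) (κ.2 + τ.2 * Complex.I) *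
          ∫ y : ℝ × ℝ, (snrWeight A c q (Real.exp y.1 + Real.exp y.2) : ℂ) *
            Complex.exp (-2 * (κ.1 + τ.1 * Complex.I) * y.1 +
              -2 * (κ.2 + τ.2 * Complex.I) * y.2)) = J
    have hpow : (2 * Real.pi) ^ ((q : ℝ) / 2 - 1 / 2) = (2 * Real.pi) ^ (((q : ℝ) - 1) / 2) := by
      congr 1; ring
    rw [hpow]
    have e0 : ((2 * Real.pi) ^ (((q : ℝ) - 1) / 2) : ℝ) ≠ 0 :=
      (Real.rpow_pos_of_pos (by positivity) _).ne'
    have e1 := (Real.sqrt_pos.mpr hq0).ne'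
    have e2 := (Real.Gamma_pos_of_pos (hms 0)).ne'
    have e3 := (Real.Gamma_pos_of_pos (hms 1)).ne'
    have e4 := (Real.Gamma_pos_of_pos (hm 0)).ne'
    have e5 := (Real.Gamma_pos_of_pos (hm 1)).ne'
    have e6 := (Real.Gamma_pos_of_pos hA).ne'
    have e7 := Real.pi_ne_zero
    have hI : ((2 * Real.pi * Complex.I) ^ 2)⁻¹ * Complex.I ^ 2 =
        ((4 * Real.pi ^ 2 : ℝ) : ℂ)⁻¹ := by
      rw [mul_pow, Complex.I_sq, mul_pow]
      push_cast
      rw [mul_neg_one, mul_neg_one, inv_neg, neg_neg]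
      norm_num
    calc _ = (((2 * Real.pi * Complex.I) ^ 2)⁻¹ * Complex.I ^ 2) *
          ((4 * Real.pi * Real.sqrt q * Real.Gamma A /
            (2 * Real.pi) ^ (((q : ℝ) - 1) / 2) : ℝ) : ℂ) * J := by ring
      _ = ((((4 * Real.pi ^ 2)⁻¹ * (4 * Real.pi * Real.sqrt q * Real.Gamma A /
            (2 * Real.pi) ^ (((q : ℝ) - 1) / 2)) : ℝ)) : ℂ) * J := by
          rw [hI, Complex.ofReal_mul (4 * Real.pi ^ 2)⁻¹, Complex.ofReal_inv]
      _ = ((((Real.pi * Real.Gamma (m 0) * Real.Gamma (ms 0))⁻¹ *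
            (Real.pi * Real.Gamma (m 1) * Real.Gamma (ms 1))⁻¹ /
            ((2 * Real.pi) ^ (((q : ℝ) - 1) / 2) / (Real.sqrt q * Real.Gamma (ms 0) *
              Real.Gamma (ms 1) * Real.Gamma (m 0) * Real.Gamma (m 1) * Real.Gamma A *
              Real.pi))) : ℝ) : ℂ) * J := by
          congr 2
          field_simp
      _ = _ := by
          rw [Complex.ofReal_div (_ * _), Complex.ofReal_mul (_⁻¹)]
          ring

/-- The expectation of `(1 + γ) ^ (-A)` over the two branches, in logarithmic coordinates. -/
theorem integral_snr_eq {Ω : Type*} [MeasurableSpace Ω] {P : Measure Ω} [IsProbabilityMeasure P]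
    {K Es N₀ p A : ℝ} {q : ℕ} {m β ms Ωs δ : Fin 2 → ℝ} (hp : p ≠ 0)
    (hm : ∀ l, 0 < m l) (hβ : ∀ l, 0 < β l) (hms : ∀ l, 0 < ms l) (hΩs : ∀ l, 0 < Ωs l)
    (hδ : ∀ l, Real.exp (2 / p * δ l) = Ωs l / (nakagamiB (m l) (β l) * ms l))
    {R : Ω → Fin 2 → ℝ}
    (hR : ∀ l, HasLaw (fun ω => R ω l) (gsnmMeasure (m l) (β l) (ms l) (Ωs l)) P)
    (hind : iIndepFun (fun l ω => R ω l) P) :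
    ∫ ω, (1 + lpNormSNR K Es N₀ p q (R ω)) ^ (-A) ∂P =
      ∫ y : ℝ × ℝ, snrWeight A (K * (Es / N₀)) q (Real.exp y.1 + Real.exp y.2) *
        (logGSNMPDF (m 0) (p / β 0) (ms 0) p (δ 0) y.1 *
          logGSNMPDF (m 1) (p / β 1) (ms 1) p (δ 1) y.2) := by
  set h : ℝ × ℝ → ℝ := fun r => snrWeight A (K * (Es / N₀)) q (r.1 ^ p + r.2 ^ p) with hh
  have hhm : Measurable h := by
    have := measurable_snrWeight A (K * (Es / N₀)) q
    simp only [hh]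
    fun_prop
  have hind2 : IndepFun (fun ω => R ω 0) (fun ω => R ω 1) P := hind.indepFun (by decide)
  have hmap := (indepFun_iff_map_prod_eq_prod_map_map (hR 0).aemeasurable
    (hR 1).aemeasurable).mp hind2
  rw [(hR 0).map_eq, (hR 1).map_eq] at hmap
  have e1 : ∀ ω, (1 + lpNormSNR K Es N₀ p q (R ω)) ^ (-A) = h (R ω 0, R ω 1) := fun ω => by
    simp only [hh, snrWeight, lpNormSNR, Fin.sum_univ_two]
  simp_rw [e1]
  rw [← integral_map ((hR 0).aemeasurable.prodMk (hR 1).aemeasurable) hhm.aestronglyMeasurable,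
    hmap, integral_gsnmMeasure_prod hm hβ hms hΩs hp hδ hhm]
  congr 1
  funext y
  simp only [hh]
  rw [← Real.exp_mul, ← Real.exp_mul, mul_right_comm, inv_mul_cancel₀ hp, one_mul, mul_right_comm,
    inv_mul_cancel₀ hp, one_mul]

theorem exp_neg_mul_serviceORA {θ T B γ : ℝ} (hγ : 0 < 1 + γ) :
    Real.exp (-θ * serviceORA T B γ) = (1 + γ) ^ (-qosExponent θ T B) := by
  rw [Real.rpow_def_of_pos hγ, serviceORA, qosExponent, Real.logb]
  congr 1
  ring

/-- Over independent blocks with the law of `R` the exponential moment of the accumulated service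
is a power, so the sequence defining the effective capacity is constant from `N = 1` on. -/
theorem isEffectiveCapacity_of_iid {Ω : Type*} [MeasurableSpace Ω] {P : Measure Ω}
    {θ T B K Es N₀ p q : ℝ} {R : Ω → Fin 2 → ℝ}
    (hpos : ∀ᵐ ω ∂P, 0 < 1 + lpNormSNR K Es N₀ p q (R ω))
    {V : ℕ → Ω → Fin 2 → ℝ} (hV : iIndepFun V P) (hVR : ∀ n, IdentDistrib (V n) R P P) :
    IsEffectiveCapacity P θ T B (fun n ω => serviceORA T B (lpNormSNR K Es N₀ p q (V n ω)))
      (-(1 / (θ * T * B)) *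
        Real.log (∫ ω, (1 + lpNormSNR K Es N₀ p q (R ω)) ^ (-qosExponent θ T B) ∂P)) := by
  set E := ∫ ω, (1 + lpNormSNR K Es N₀ p q (R ω)) ^ (-qosExponent θ T B) ∂P with hE
  set f : (Fin 2 → ℝ) → ℝ := fun v => Real.exp (-θ * serviceORA T B (lpNormSNR K Es N₀ p q v))
    with hf
  have hfm : Measurable f := by
    simp only [hf, serviceORA, lpNormSNR, Real.logb]
    fun_prop
  have h1 : ∀ n, ∫ ω, f (V n ω) ∂P = E := fun n => by
    have h2 : ∫ ω, f (V n ω) ∂P = ∫ ω, f (R ω) ∂P := ((hVR n).comp hfm).integral_eq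
    rw [h2, hE]
    refine integral_congr_ae ?_
    filter_upwards [hpos] with ω hω
    exact exp_neg_mul_serviceORA hω
  have h2 : ∀ N : ℕ, ∫ ω, Real.exp (-θ * ∑ n ∈ Finset.range N,
      serviceORA T B (lpNormSNR K Es N₀ p q (V n ω))) ∂P = E ^ N := fun N => by
    have h3 : ∀ ω, Real.exp (-θ * ∑ n ∈ Finset.range N,
        serviceORA T B (lpNormSNR K Es N₀ p q (V n ω))) = ∏ i : Fin N, f (V i ω) := fun ω => by
      rw [Finset.mul_sum, Real.exp_sum, Finset.prod_range]
    simp_rw [h3]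
    rw [(hV.precomp Fin.val_injective).integral_fun_prod_comp (X := fun (i : Fin N) => V i)
      (f := fun _ => f) (fun i => (hVR i).aemeasurable_fst) (fun i => hfm.aestronglyMeasurable)]
    simp [h1]
  unfold IsEffectiveCapacity
  simp_rw [h2]
  refine tendsto_const_nhds.congr' ?_
  -- `N = 0` is left out: the factor `1 / N` vanishes there
  filter_upwards [eventually_ge_atTop 1] with N hN
  have hN0 : (N : ℝ) ≠ 0 := by positivity
  rw [Real.log_pow]
  field_simp

theorem proposition2 {Ω : Type*} [MeasurableSpace Ω] (P : Measure Ω) [IsProbabilityMeasure P]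
    (θ T B K Es N₀ p : ℝ) (q : ℕ) (m β ms Ωs : Fin 2 → ℝ)
    (hθ : 0 < θ) (hT : 0 < T) (hB : 0 < B) (hK : 0 < K) (hEs : 0 < Es) (hN₀ : 0 < N₀)
    (hp : p ≠ 0) (hq : 1 ≤ q)
    (hm : ∀ l, 1 / 2 ≤ m l) (hβ : ∀ l, 0 < β l) (hms : ∀ l, 1 / 2 ≤ ms l) (hΩs : ∀ l, 0 < Ωs l)
    -- the fading envelopes of the two branches
    (R : Ω → Fin 2 → ℝ)
    (hR : ∀ l, HasLaw (fun ω => R ω l) (gsnmMeasure (m l) (β l) (ms l) (Ωs l)) P)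
    (hind : iIndepFun (fun l ω => R ω l) P)
    -- abbreviations used in the conclusion
    (A : ℝ) (hA : A = qosExponent θ T B)
    (x : Fin 2 → ℝ)
    (hx : ∀ l, x l = (Ωs l / (nakagamiB (m l) (β l) * ms l)) ^ p *
      ((K * (Es / N₀)) ^ (2 / (q : ℝ)) * (q : ℝ) ^ 2 / 4))
    (D : ℝ)
    (hD : D = (2 * Real.pi) ^ ((q : ℝ) / 2 - 1 / 2) /
      (Real.sqrt q * Real.Gamma (ms 0) * Real.Gamma (ms 1) * Real.Gamma (m 0) *
        Real.Gamma (m 1) * Real.Gamma A * Real.pi))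
    (H : ℂ) (hH : H = bivariateFoxH (dualGSNMFoxHData q p A m β ms) (x 0) (x 1)) :
    -- the H-function is well defined at the arguments and is a positive real number there
    (dualGSNMFoxHData q p A m β ms).WellDefined (x 0) (x 1) ∧ H.im = 0 ∧ 0 < H.re ∧
    -- the closed form of the effective capacity
    effectiveCapacityORA P θ T B (fun ω => lpNormSNR K Es N₀ p q (R ω)) =
      -(1 / (θ * T * B)) * Real.log (D * H.re) ∧
    -- the same for its definition as a limit, over independent blocks distributed like `R`
    (∀ V : ℕ → Ω → Fin 2 → ℝ, iIndepFun V P → (∀ n, IdentDistrib (V n) R P P) →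
      IsEffectiveCapacity P θ T B
        (fun n ω => serviceORA T B (lpNormSNR K Es N₀ p q (V n ω)))
        (-(1 / (θ * T * B)) * Real.log (D * H.re))) := by
  have hm' : ∀ l, 0 < m l := fun l => by linarith [hm l]
  have hms' : ∀ l, 0 < ms l := fun l => by linarith [hms l]
  have hc : 0 < K * (Es / N₀) := by positivity
  have hA0 : 0 < A := by
    rw [hA, qosExponent]
    have := Real.log_pos one_lt_two
    positivity
  have hb : ∀ l, 0 < nakagamiB (m l) (β l) := fun l => nakagamiB_pos (hm' l) (hβ l)
  have hy : ∀ l, 0 < Ωs l / (nakagamiB (m l) (β l) * ms l) := fun l =>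
    div_pos (hΩs l) (mul_pos (hb l) (hms' l))
  -- the shift of `log (R ^ p)` due to the mean power
  set δ : Fin 2 → ℝ := fun l => p / 2 * Real.log (Ωs l / (nakagamiB (m l) (β l) * ms l)) with hδ
  have hδ' : ∀ l, Real.exp (2 / p * δ l) = Ωs l / (nakagamiB (m l) (β l) * ms l) := fun l => by
    simp only [hδ]
    rw [← mul_assoc, div_mul_div_cancel₀ hp, div_self two_ne_zero, one_mul, Real.exp_log (hy l)]
  have hx' : ∀ l, x l = Real.exp (2 * δ l) *
      ((K * (Es / N₀)) ^ (2 / (q : ℝ)) * (q : ℝ) ^ 2 / 4) := fun l => by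
    rw [hx, Real.rpow_def_of_pos (hy l)]
    simp only [hδ]
    congr 2
    ring
  have hMB := fun κ => mellinBarnes_dual (κ := κ) hq hp hA0 hc hm' hβ hms' hx'
  have hE := integral_snr_eq (K := K) (Es := Es) (N₀ := N₀) (A := A) (q := q) hp hm' hβ hms' hΩs
    hδ' hR hind
  rw [← hE, ← hD] at hMB
  set E := ∫ ω, (1 + lpNormSNR K Es N₀ p q (R ω)) ^ (-A) ∂P with hEdef
  have hD0 : 0 < D := by
    rw [hD]
    have h1 := Real.Gamma_pos_of_pos (hms' 0)
    have h2 := Real.Gamma_pos_of_pos (hms' 1)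
    have h3 := Real.Gamma_pos_of_pos (hm' 0)
    have h4 := Real.Gamma_pos_of_pos (hm' 1)
    have h5 := Real.Gamma_pos_of_pos hA0
    have h6 := Real.pi_pos
    positivity
  have hRpos : ∀ᵐ ω ∂P, ∀ l, 0 < R ω l := by
    rw [ae_all_iff]
    intro l
    exact ((hR l).ae_iff (measurableSet_setOfPred.mp measurableSet_Ioi)).mpr
      (ae_gsnmMeasure_pos _ _ _ _)
  have hsum : ∀ᵐ ω ∂P, 0 ≤ ∑ l, R ω l ^ p := by
    filter_upwards [hRpos] with ω hω
    exact Finset.sum_nonneg fun l _ => (Real.rpow_pos_of_pos (hω l) p).le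
  have hE0 : 0 < E := by
    have hpos : ∀ᵐ ω ∂P, 0 < (1 + lpNormSNR K Es N₀ p q (R ω)) ^ (-A) := by
      filter_upwards [hsum] with ω hω
      exact snrWeight_pos hc hω
    have hRm : AEMeasurable R P := aemeasurable_pi_lambda _ fun l => (hR l).aemeasurable
    have hm2 : Measurable fun v : Fin 2 → ℝ => (1 + lpNormSNR K Es N₀ p q v) ^ (-A) := by
      simp only [lpNormSNR]
      fun_prop
    have hint : Integrable (fun ω => (1 + lpNormSNR K Es N₀ p q (R ω)) ^ (-A)) P := by
      refine (integrable_const (1 : ℝ)).mono' (hm2.comp_aemeasurable hRm).aestronglyMeasurable ?_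
      filter_upwards [hsum, hpos] with ω hω h
      rw [Real.norm_of_nonneg h.le]
      exact snrWeight_le_one hA0 hc hω
    refine lt_of_le_of_ne (integral_nonneg_of_ae (hpos.mono fun _ h => h.le)) fun h0 => ?_
    rw [eq_comm, hEdef, integral_eq_zero_iff_of_nonneg_ae (hpos.mono fun _ h => h.le) hint] at h0
    obtain ⟨ω, h1, h2⟩ := (hpos.and h0).exists
    exact h1.ne' h2
  have hex := exists_admissible_dual q p hA0 β hm' hms' (m := m) (ms := ms)
  have hHval : H = ((E / D : ℝ) : ℂ) := by
    rw [hH, bivariateFoxH, dif_pos hex]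
    exact (hMB _ hex.choose_spec).2
  have hHre : H.re = E / D := by rw [hHval, Complex.ofReal_re]
  have hDH : D * H.re = E := by rw [hHre, mul_div_cancel₀ _ hD0.ne']
  refine ⟨⟨hex, fun κ hκ => (hMB κ hκ).1, fun κ κ' hκ hκ' => ?_⟩, ?_, ?_, ?_, ?_⟩
  · rw [(hMB κ hκ).2, (hMB κ' hκ').2]
  · rw [hHval, Complex.ofReal_im]
  · rw [hHre]
    exact div_pos hE0 hD0
  · rw [hDH, effectiveCapacityORA, ← hA]
  · intro V hV hVR
    rw [hDH, hEdef, hA]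
    refine isEffectiveCapacity_of_iid ?_ hV hVR
    filter_upwards [hsum] with ω hω
    have : 0 ≤ K * (Es / N₀) * (∑ l, R ω l ^ p) ^ (q : ℝ) := by positivity
    simp only [lpNormSNR]
    linarith
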